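/- All Hilbert spaces are finite-dimensional and complex, and $\log$ is the logarithm to base $2$. A sub-normalized state on $\mathcal H$ is a positive semidefinite operator $\rho$ with $\operatorname{tr}\rho\le 1$; write $\mathcal S_\le(\mathcal H)$ for the set of these. For positive semidefinite $\rho,\sigma$ let $F(\rho,\sigma)=\|\sqrt\rho\sqrt\sigma\|_1$, where $\|X\|_1=\operatorname{tr}\sqrt{X^\dagger X}$. For $\rho,\sigma\in\mathcal S_\le(\mathcal H)$ let $$P(\rho,\sigma)=\sqrt{1-\Bigl(F(\rho,\sigma)+\sqrt{(1-\operatorname{tr}\rho)(1-\operatorname{tr}\sigma)}\Bigr)^2}$$ be the purified distance. For $\rho_{AB}\in\mathcal S_\le(\mathcal H_A\otimes\mathcal H_B)$ define, with values in $[-\infty,\infty]$ (where $\log 0=-\infty$ and $\sup\emptyset=-\infty$), $$H_{\min}(A|B)_\rho=\sup_{\sigma_B\in\mathcal S_\le(\mathcal H_B)}\sup\{\lambda\in\mathbb R:\rho_{AB}\le 2^{-\lambda}\,1_A\otimes\sigma_B\},\qquad H_{\max}(A|B)_\rho=\sup_{\sigma_B\in\mathcal S_\le(\mathcal H_B)}\log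 F(\rho_{AB},1_A\otimes\sigma_B)^2,$$ and, for $\varepsilon\ge 0$, $$H_{\min}^{\varepsilon}(A|B)_\rho=\sup_{\tilde\rho}H_{\min}(A|B)_{\tilde\rho},\qquad H_{\max}^{\varepsilon}(A|B)_\rho=\inf_{\tilde\rho}H_{\max}(A|B)_{\tilde\rho},$$ where $\tilde\rho$ ranges over all $\tilde\rho_{AB}\in\mathcal S_\le(\mathcal H_A\otimes\mathcal H_B)$ with $P(\tilde\rho,\rho)\le\varepsilon$. Let $$f(\varepsilon)=\log\frac{1}{1-\sqrt{1-\varepsilon^2}}\quad(0<\varepsilon\le 1),\qquad f(\varepsilon)=0\quad(\varepsilon>1).$$ **Theorem.** Let $\varepsilon>0$, $\varepsilon',\varepsilon''\ge 0$, and let $\rho_{ABC}$ be a sub-normalized state on $\mathcal H_A\otimes\mathcal H_B\otimes\mathcal H_C$ with $\varepsilon''<\sqrt{\operatorname{tr}\rho_{ABC}}$. Then $$H_{\min}^{\varepsilon'}(AB|C)_\rho\le H_{\max}^{\varepsilon''}(A|BC)_\rho+H_{\min}^{2\varepsilon+\varepsilon'+2\varepsilon''}(B|C)_\rho+3f(\varepsilon),$$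 where $H_{\min}(B|C)_\rho$ refers to the reduced state $\rho_{BC}=\operatorname{tr}_A\rho_{ABC}$. -/

import Mathlib

open scoped Matrix Kronecker MatrixOrder ComplexOrder

noncomputable section

namespace SmoothEntropy

/-- `IsSubState ρ`: the operator `ρ` on the Hilbert space `ℂ^n` is a sub-normalized state,
i.e. it is positive semidefinite and `tr ρ ≤ 1`. -/
def IsSubState {n : Type*} [Fintype n] (ρ : Matrix n n ℂ) : Prop :=
  ρ.PosSemidef ∧ ρ.trace.re ≤ 1

/-- Partial trace over the first tensor factor. -/
def traceFst {a b : Type*} [Fintype a] (X : Matrix (a × b) (a × b) ℂ) : Matrix b b ℂ :=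
  Matrix.of fun i j => ∑ k, X (k, i) (k, j)

/-- The trace norm `‖X‖₁ = tr √(X† X)`. -/
def traceNorm {n : Type*} [Fintype n] [DecidableEq n] (X : Matrix n n ℂ) : ℝ :=
  (CFC.sqrt (Xᴴ * X)).trace.re

/-- The fidelity `F(ρ, σ) = ‖√ρ √σ‖₁`. -/
def fidelity {n : Type*} [Fintype n] [DecidableEq n] (ρ σ : Matrix n n ℂ) : ℝ :=
  traceNorm (CFC.sqrt ρ * CFC.sqrt σ)

/-- The generalized fidelity of two sub-normalized states. -/
def genFidelity {n : Type*} [Fintype n] [DecidableEq n] (ρ σ : Matrix n n ℂ) : ℝ :=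
  fidelity ρ σ + Real.sqrt ((1 - ρ.trace.re) * (1 - σ.trace.re))

/-- The purified distance of two sub-normalized states. -/
def purifiedDist {n : Type*} [Fintype n] [DecidableEq n] (ρ σ : Matrix n n ℂ) : ℝ :=
  Real.sqrt (1 - genFidelity ρ σ ^ 2)

/-- The set of sub-normalized states that are `ε`-close to `ρ` in purified distance. -/
def closeStates {n : Type*} [Fintype n] [DecidableEq n] (ε : ℝ) (ρ : Matrix n n ℂ) :
    Set (Matrix n n ℂ) :=
  {ρ' | IsSubState ρ' ∧ purifiedDist ρ' ρ ≤ ε}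

/-- The logarithm to base `2` of a nonnegative real, with `log 0 = -∞`. -/
def elog2 (x : ℝ) : EReal :=
  if x ≤ 0 then ⊥ else ((Real.logb 2 x : ℝ) : EReal)

/-- `H_min(A|B)_{ρ|σ}`: the supremum in `[-∞, ∞]` of all real `l` with
`ρ_AB ≤ 2^{-l} 1_A ⊗ σ_B`. -/
def hMinRel {a b : Type*} [Fintype a] [DecidableEq a] [Fintype b] [DecidableEq b]
    (ρ : Matrix (a × b) (a × b) ℂ) (σ : Matrix b b ℂ) : EReal :=
  ⨆ (l : ℝ) (_ : ρ ≤ ((2 : ℝ) ^ (-l)) • ((1 : Matrix a a ℂ) ⊗ₖ σ)), (l : EReal)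

/-- The conditional min-entropy `H_min(A|B)_ρ`. -/
def hMin {a b : Type*} [Fintype a] [DecidableEq a] [Fintype b] [DecidableEq b]
    (ρ : Matrix (a × b) (a × b) ℂ) : EReal :=
  ⨆ (σ : Matrix b b ℂ) (_ : IsSubState σ), hMinRel ρ σ

/-- `H_max(A|B)_{ρ|σ} = log F(ρ_AB, 1_A ⊗ σ_B)²`. -/
def hMaxRel {a b : Type*} [Fintype a] [DecidableEq a] [Fintype b] [DecidableEq b]
    (ρ : Matrix (a × b) (a × b) ℂ) (σ : Matrix b b ℂ) : EReal :=
  elog2 (fidelity ρ ((1 : Matrix a a ℂ) ⊗ₖ σ) ^ 2)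

/-- The conditional max-entropy `H_max(A|B)_ρ`. -/
def hMax {a b : Type*} [Fintype a] [DecidableEq a] [Fintype b] [DecidableEq b]
    (ρ : Matrix (a × b) (a × b) ℂ) : EReal :=
  ⨆ (σ : Matrix b b ℂ) (_ : IsSubState σ), hMaxRel ρ σ

/-- The `ε`-smooth conditional min-entropy `H_min^ε(A|B)_ρ`. -/
def smoothHMin {a b : Type*} [Fintype a] [DecidableEq a] [Fintype b] [DecidableEq b]
    (ε : ℝ) (ρ : Matrix (a × b) (a × b) ℂ) : EReal :=
  ⨆ ρ' ∈ closeStates ε ρ, hMin ρ'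

/-- The `ε`-smooth conditional max-entropy `H_max^ε(A|B)_ρ`. -/
def smoothHMax {a b : Type*} [Fintype a] [DecidableEq a] [Fintype b] [DecidableEq b]
    (ε : ℝ) (ρ : Matrix (a × b) (a × b) ℂ) : EReal :=
  ⨅ ρ' ∈ closeStates ε ρ, hMax ρ'

/-- An operator on `A ⊗ (B ⊗ C)` regarded as an operator on `(A ⊗ B) ⊗ C`. -/
def assocLeft {a b c : Type*} (ρ : Matrix (a × b × c) (a × b × c) ℂ) :
    Matrix ((a × b) × c) ((a × b) × c) ℂ :=
  ρ.submatrix (Equiv.prodAssoc a b c) (Equiv.prodAssoc a b c)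

/-- The error term `f(ε) = log₂ (1 / (1 - √(1 - ε²)))`. For `ε > 1` the value is `0`, because
`Real.sqrt` vanishes on negative numbers. -/
def errorTerm (ε : ℝ) : ℝ :=
  Real.logb 2 (1 / (1 - Real.sqrt (1 - ε ^ 2)))

end SmoothEntropy

end

/-!
Operators are replaced by purifications, which are vectors of a Hilbert–Schmidt space. There the
purified distance, `√(1 - |⟨x, y⟩|²)` once vectors of norm at most one are completed to unit
vectors, obeys the triangle inequality and does not increase under a common orthogonal projection;
Uhlmann's theorem carries this over to operators. Regrouping the indices of a purification `R` so
that the factor `A` purifies as well turns `R` into a purification of the reduced operator.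

Let `R₁` and `R₂` purify the operators realizing the min-entropy of `AB` given `C` and the
max-entropy of `A` given `BC`, and let `δ = 1 - √(1 - ε²)`. The bound `R₁ R₁† ≤ r • (1 ⊗ σ)`
factors `R₁` through `1 ⊗ √σ`, and a spectral projection `P` of the second factor, acting on the
purifying side, changes `R₁` by at most `ε` and satisfies `δ • tr_A (tr_B P) ≤ r • 1`. Since the
fidelities of `R₂ R₂†` with `1 ⊗ τ` are bounded by `√M`, a spectral projection `E` of `tr_B P`
changes `R₂` by at most `ε` and satisfies `E (tr_B P) E ≤ (r M / δ) • 1`. Applying first `P` and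
then `E` to `R₁` gives the required operator: it is at most `(r M / δ²) • (1 ⊗ ω)`, and the
distances add up to `ε + ε' + 2 ε'' + ε`, where `ε''` is counted twice because `E` is compared on
`R₁` and `R₂` through the original state.
-/

noncomputable section

namespace SmoothEntropy

lemma one_sub_norm_sq_nonneg {E : Type*} [SeminormedAddGroup E] {u : E} (hu : ‖u‖ ≤ 1) :
    0 ≤ 1 - ‖u‖ ^ 2 :=
  sub_nonneg.2 (pow_le_one₀ (norm_nonneg u) hu)

section Triangle

variable {𝕜 E : Type*} [RCLike 𝕜] [NormedAddCommGroup E] [InnerProductSpace 𝕜 E] {x y z : E}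

lemma norm_sub_smul_sq (hx : ‖x‖ = 1) (hy : ‖y‖ = 1) (c : 𝕜) :
    ‖x - c • y‖ ^ 2 = 1 - ‖inner 𝕜 x y‖ ^ 2 + ‖c - inner 𝕜 y x‖ ^ 2 := by
  have hre : RCLike.re (inner 𝕜 c (inner 𝕜 y x)) = RCLike.re (c * inner 𝕜 x y) := by
    rw [RCLike.inner_apply, ← inner_conj_symm y x, ← map_mul, RCLike.conj_re, mul_comm]
  rw [norm_sub_sq (𝕜 := 𝕜) x, norm_sub_sq (𝕜 := 𝕜) c, hre, norm_smul, inner_smul_right, hx, hy,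
    norm_inner_symm y x]
  ring

lemma sqrt_one_sub_norm_inner_sq_le (hx : ‖x‖ = 1) (hy : ‖y‖ = 1) (c : 𝕜) :
    √(1 - ‖inner 𝕜 x y‖ ^ 2) ≤ ‖x - c • y‖ :=
  Real.sqrt_le_iff.2 ⟨norm_nonneg _, by
    rw [norm_sub_smul_sq hx hy]; exact le_add_of_nonneg_right (sq_nonneg _)⟩

lemma norm_sub_inner_smul (hx : ‖x‖ = 1) (hy : ‖y‖ = 1) :
    ‖x - inner 𝕜 y x • y‖ = √(1 - ‖inner 𝕜 x y‖ ^ 2) := by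
  rw [← Real.sqrt_sq (norm_nonneg (x - _)), norm_sub_smul_sq hx hy, sub_self, norm_zero,
    zero_pow two_ne_zero, add_zero]

-- The quantity `√(1 - |⟨x, y⟩|²)` is the distance from `x` to the line spanned by `y`.
lemma sqrt_one_sub_norm_inner_sq_triangle (hx : ‖x‖ = 1) (hy : ‖y‖ = 1) (hz : ‖z‖ = 1) :
    √(1 - ‖inner 𝕜 x z‖ ^ 2) ≤ √(1 - ‖inner 𝕜 x y‖ ^ 2) + √(1 - ‖inner 𝕜 y z‖ ^ 2) := by
  have hxy : ‖inner 𝕜 y x‖ ≤ 1 := by simpa [hx, hy] using norm_inner_le_norm (𝕜 := 𝕜) y x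
  calc √(1 - ‖inner 𝕜 x z‖ ^ 2) ≤ ‖x - (inner 𝕜 y x * inner 𝕜 z y) • z‖ :=
        sqrt_one_sub_norm_inner_sq_le hx hz _
    _ = ‖(x - inner 𝕜 y x • y) + inner 𝕜 y x • (y - inner 𝕜 z y • z)‖ := by
        rw [mul_smul, smul_sub, sub_add_sub_cancel]
    _ ≤ ‖x - inner 𝕜 y x • y‖ + ‖inner 𝕜 y x‖ * ‖y - inner 𝕜 z y • z‖ :=
        (norm_add_le _ _).trans_eq (by rw [norm_smul])
    _ ≤ ‖x - inner 𝕜 y x • y‖ + ‖y - inner 𝕜 z y • z‖ := by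
        gcongr; exact mul_le_of_le_one_left (norm_nonneg _) hxy
    _ = _ := by rw [norm_sub_inner_smul hx hy, norm_sub_inner_smul hy hz]

end Triangle

section PureVectors

variable {E : Type*} [NormedAddCommGroup E] {u v w : E}

/-- A vector of norm at most one completed to a unit vector, with a free phase `z` in the added
coordinate. -/
def completeVec (u : E) (z : Circle) : WithLp 2 (E × ℂ) :=
  WithLp.toLp 2 (u, √(1 - ‖u‖ ^ 2) * z)

lemma norm_completeVec (hu : ‖u‖ ≤ 1) (z : Circle) : ‖completeVec u z‖ = 1 := by
  rw [← sq_eq_sq₀ (norm_nonneg _) zero_le_one, WithLp.prod_norm_sq_eq_of_L2]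
  simp [completeVec, Real.sq_sqrt (one_sub_norm_sq_nonneg hu), Circle.norm_coe]

variable [InnerProductSpace ℂ E]

/-- The generalized fidelity of two vectors of norm at most one, each standing for the
sub-normalized pure state it spans. -/
def pureFidelity (u v : E) : ℝ :=
  ‖inner ℂ u v‖ + √((1 - ‖u‖ ^ 2) * (1 - ‖v‖ ^ 2))

/-- The purified distance of two vectors of norm at most one. -/
def pureDist (u v : E) : ℝ :=
  √(1 - pureFidelity u v ^ 2)

lemma pureFidelity_nonneg (u v : E) : 0 ≤ pureFidelity u v := by
  unfold pureFidelity; positivity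

lemma pureFidelity_comm (u v : E) : pureFidelity u v = pureFidelity v u := by
  rw [pureFidelity, pureFidelity, norm_inner_symm, mul_comm]

lemma pureDist_comm (u v : E) : pureDist u v = pureDist v u := by
  rw [pureDist, pureDist, pureFidelity_comm]

lemma inner_completeVec (u v : E) (z y : Circle) :
    inner ℂ (completeVec u z) (completeVec v y)
      = inner ℂ u v + ((√(1 - ‖u‖ ^ 2) * √(1 - ‖v‖ ^ 2) : ℝ) : ℂ) * (z⁻¹ * y : Circle) := by
  simp [completeVec, ← Circle.coe_inv_eq_conj]
  ring

lemma norm_inner_completeVec_le (hu : ‖u‖ ≤ 1) (z y : Circle) :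
    ‖inner ℂ (completeVec u z) (completeVec v y)‖ ≤ pureFidelity u v := by
  rw [inner_completeVec, pureFidelity, Real.sqrt_mul (one_sub_norm_sq_nonneg hu)]
  refine (norm_add_le _ _).trans_eq ?_
  rw [norm_mul, Circle.norm_coe, mul_one, Complex.norm_real, Real.norm_of_nonneg (by positivity)]

lemma exists_norm_inner_completeVec_eq (hu : ‖u‖ ≤ 1) (v : E) (y : Circle) :
    ∃ z, ‖inner ℂ (completeVec u z) (completeVec v y)‖ = pureFidelity u v := by
  obtain ⟨c, hc, hcv⟩ := Complex.exists_norm_mul_eq_self (inner ℂ u v)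
  let c' : Circle := ⟨c, mem_sphere_zero_iff_norm.2 hc⟩
  refine ⟨y * c'⁻¹, ?_⟩
  rw [inner_completeVec, pureFidelity, Real.sqrt_mul (one_sub_norm_sq_nonneg hu),
    show (y * c'⁻¹)⁻¹ * y = c' by group]
  nth_rw 1 [← hcv]
  rw [mul_comm c, ← add_mul, ← Complex.ofReal_add, norm_mul, hc, mul_one, Complex.norm_real,
    Real.norm_of_nonneg (by positivity)]

lemma pureDist_triangle (hu : ‖u‖ ≤ 1) (hv : ‖v‖ ≤ 1) (hw : ‖w‖ ≤ 1) :
    pureDist u w ≤ pureDist u v + pureDist v w := by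
  obtain ⟨z, hz⟩ := exists_norm_inner_completeVec_eq hu v 1
  obtain ⟨y, hy⟩ := exists_norm_inner_completeVec_eq hw v 1
  rw [norm_inner_symm, pureFidelity_comm] at hy
  calc pureDist u w ≤ √(1 - ‖inner ℂ (completeVec u z) (completeVec w y)‖ ^ 2) := by
        unfold pureDist; gcongr; exact norm_inner_completeVec_le hu z y
    _ ≤ √(1 - ‖inner ℂ (completeVec u z) (completeVec v 1)‖ ^ 2)
          + √(1 - ‖inner ℂ (completeVec v 1) (completeVec w y)‖ ^ 2) :=
        sqrt_one_sub_norm_inner_sq_triangle (norm_completeVec hu z) (norm_completeVec hv 1)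
          (norm_completeVec hw y)
    _ = pureDist u v + pureDist v w := by rw [hz, hy, pureDist, pureDist]

end PureVectors

section SymmetricProjection

variable {𝕜 E : Type*} [RCLike 𝕜] [NormedAddCommGroup E] [InnerProductSpace 𝕜 E] {T : E →ₗ[𝕜] E}

lemma inner_map_sub_map_eq_zero (hT : T.IsSymmetricProjection) (u v : E) :
    inner 𝕜 (T u) (v - T v) = 0 := by
  rw [hT.isSymmetric, map_sub, ← Module.End.mul_apply, hT.isIdempotentElem.eq, sub_self,
    inner_zero_right]

lemma norm_sq_eq_norm_map_sq_add (hT : T.IsSymmetricProjection) (u : E) :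
    ‖u‖ ^ 2 = ‖T u‖ ^ 2 + ‖u - T u‖ ^ 2 := by
  have h := norm_add_sq_eq_norm_sq_add_norm_sq_of_inner_eq_zero (𝕜 := 𝕜) _ _
    (inner_map_sub_map_eq_zero hT u u)
  rw [add_sub_cancel] at h
  simpa only [sq] using h

lemma norm_map_le_norm (hT : T.IsSymmetricProjection) (u : E) : ‖T u‖ ≤ ‖u‖ :=
  (sq_le_sq₀ (norm_nonneg _) (norm_nonneg _)).1
    ((norm_sq_eq_norm_map_sq_add hT u).symm ▸ le_add_of_nonneg_right (sq_nonneg _))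

lemma inner_eq_inner_map_add (hT : T.IsSymmetricProjection) (u v : E) :
    inner 𝕜 u v = inner 𝕜 (T u) (T v) + inner 𝕜 (u - T u) (v - T v) := by
  rw [inner_sub_left, inner_map_sub_map_eq_zero hT, inner_sub_right, hT.isSymmetric u (T v),
    ← Module.End.mul_apply, hT.isIdempotentElem.eq]
  ring

lemma inner_map_self_eq_norm_sq (hT : T.IsSymmetricProjection) (u : E) :
    inner 𝕜 (T u) u = (‖T u‖ : 𝕜) ^ 2 := by
  rw [inner_eq_inner_map_add hT, ← Module.End.mul_apply, hT.isIdempotentElem.eq, sub_self,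
    inner_zero_left, add_zero, inner_self_eq_norm_sq_to_K]

end SymmetricProjection

section PureProjection

variable {E : Type*} [NormedAddCommGroup E] [InnerProductSpace ℂ E] {T : E →ₗ[ℂ] E} {u v w : E}

lemma sqrt_mul_add_mul_le {p q s t : ℝ} (hp : 0 ≤ p) (hq : 0 ≤ q) (hs : 0 ≤ s) (ht : 0 ≤ t) :
    √(p * q) + s * t ≤ √((p + s ^ 2) * (q + t ^ 2)) := by
  have h := Real.sum_sqrt_mul_sqrt_le (Finset.univ (α := Fin 2)) (f := ![p, s ^ 2])
    (g := ![q, t ^ 2]) (by simp [Fin.forall_fin_two, hp, sq_nonneg])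
    (by simp [Fin.forall_fin_two, hq, sq_nonneg])
  simpa [Fin.sum_univ_two, hs, ht, Real.sqrt_mul, hp, add_nonneg, sq_nonneg] using h

lemma pureDist_map_map_le (hT : T.IsSymmetricProjection) (hu : ‖u‖ ≤ 1) (hv : ‖v‖ ≤ 1) :
    pureDist (T u) (T v) ≤ pureDist u v := by
  have hle : pureFidelity u v ≤ pureFidelity (T u) (T v) := by
    have hinner : ‖inner ℂ u v‖ ≤ ‖inner ℂ (T u) (T v)‖ + ‖u - T u‖ * ‖v - T v‖ := by
      rw [inner_eq_inner_map_add hT u v]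
      grw [norm_add_le, norm_inner_le_norm (𝕜 := ℂ) (u - T u)]
    have hsqrt := sqrt_mul_add_mul_le (one_sub_norm_sq_nonneg hu) (one_sub_norm_sq_nonneg hv)
      (norm_nonneg (u - T u)) (norm_nonneg (v - T v))
    have hcompl (x : E) : 1 - ‖x‖ ^ 2 + ‖x - T x‖ ^ 2 = 1 - ‖T x‖ ^ 2 := by
      rw [norm_sq_eq_norm_map_sq_add hT x]; ring
    rw [hcompl, hcompl] at hsqrt
    unfold pureFidelity
    linarith
  have := pureFidelity_nonneg u v
  unfold pureDist
  gcongr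

lemma pureDist_map_self_le (hT : T.IsSymmetricProjection) (hu : ‖u‖ ≤ 1) {ε : ℝ} (hε : 0 ≤ ε)
    (h : ‖u - T u‖ ^ 2 ≤ 1 - √(1 - ε ^ 2)) : pureDist (T u) u ≤ ε := by
  have hpyth := norm_sq_eq_norm_map_sq_add hT u
  have hu₁ := one_sub_norm_sq_nonneg hu
  have hinner : ‖inner ℂ (T u) u‖ = ‖T u‖ ^ 2 := by
    rw [inner_map_self_eq_norm_sq hT, norm_pow, RCLike.norm_ofReal, abs_norm]
  have hcompl : 1 - ‖u‖ ^ 2 ≤ √((1 - ‖T u‖ ^ 2) * (1 - ‖u‖ ^ 2)) := by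
    refine Real.le_sqrt_of_sq_le ?_
    rw [sq]
    gcongr
    exact norm_map_le_norm hT u
  have hfid : √(1 - ε ^ 2) ≤ pureFidelity (T u) u := by
    unfold pureFidelity
    linarith
  refine Real.sqrt_le_iff.2 ⟨hε, ?_⟩
  linarith [(Real.sqrt_le_left (pureFidelity_nonneg (T u) u)).1 hfid]

lemma pureDist_map_le_add (hT : T.IsSymmetricProjection) (hu : ‖u‖ ≤ 1) (hv : ‖v‖ ≤ 1)
    (hw : ‖w‖ ≤ 1) :
    pureDist (T v) u ≤ pureDist v u + 2 * pureDist w u + pureDist (T w) w := by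
  have hTu := (norm_map_le_norm hT u).trans hu
  have hTv := (norm_map_le_norm hT v).trans hv
  have hTw := (norm_map_le_norm hT w).trans hw
  calc pureDist (T v) u
      ≤ pureDist (T v) (T u) + (pureDist (T u) (T w) + (pureDist (T w) w + pureDist w u)) :=
        (pureDist_triangle hTv hTu hu).trans <| by
          grw [pureDist_triangle hTu hTw hu, pureDist_triangle hTw hw hu]
    _ ≤ pureDist v u + (pureDist u w + (pureDist (T w) w + pureDist w u)) := by
        grw [pureDist_map_map_le hT hv hu, pureDist_map_map_le hT hu hw]
    _ = _ := by rw [pureDist_comm u w]; ring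

end PureProjection

section HilbertSchmidt

variable {m n : Type*}

/-- A matrix as a vector of the Hilbert–Schmidt space, the Hilbert space in which purifications
live. The indices are swapped to match `Matrix.vec`. -/
def hsVec : Matrix m n ℂ ≃ₗ[ℂ] EuclideanSpace ℂ (n × m) where
  toFun X := WithLp.toLp 2 X.vec
  invFun v := Matrix.of fun i j => v (j, i)
  map_add' _ _ := rfl
  map_smul' _ _ := rfl
  left_inv _ := rfl
  right_inv _ := rfl

variable [Fintype n]

variable (m) in
/-- Right multiplication by `P`, as an operator on Hilbert–Schmidt vectors. -/
def hsMulRight (P : Matrix n n ℂ) :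
    EuclideanSpace ℂ (n × m) →ₗ[ℂ] EuclideanSpace ℂ (n × m) :=
  hsVec.conj (mulRightLinearMap m ℂ P)

lemma hsMulRight_hsVec (P : Matrix n n ℂ) (X : Matrix m n ℂ) :
    hsMulRight m P (hsVec X) = hsVec (X * P) := by
  simp [hsMulRight, LinearEquiv.conj_apply]

variable [Fintype m]

lemma inner_hsVec (X Y : Matrix m n ℂ) : inner ℂ (hsVec X) (hsVec Y) = (Xᴴ * Y).trace := by
  rw [EuclideanSpace.inner_eq_star_dotProduct, dotProduct_comm]
  exact Matrix.star_vec_dotProduct_vec X Y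

lemma norm_hsVec_sq (X : Matrix m n ℂ) : ‖hsVec X‖ ^ 2 = (Xᴴ * X).trace.re := by
  rw [← inner_hsVec]
  exact norm_sq_eq_re_inner (𝕜 := ℂ) _

lemma norm_hsVec_sq_eq_trace_mul_conjTranspose (X : Matrix m n ℂ) :
    ‖hsVec X‖ ^ 2 = (X * Xᴴ).trace.re := by
  rw [norm_hsVec_sq, Matrix.trace_mul_comm]

lemma norm_hsVec_le_one_iff {X : Matrix m n ℂ} : ‖hsVec X‖ ≤ 1 ↔ IsSubState (X * Xᴴ) := by
  rw [IsSubState, and_iff_right (Matrix.posSemidef_self_mul_conjTranspose X),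
    ← norm_hsVec_sq_eq_trace_mul_conjTranspose, sq_le_one_iff₀ (norm_nonneg _)]

lemma isSymmetricProjection_hsMulRight {P : Matrix n n ℂ} (hP : IsStarProjection P) :
    (hsMulRight m P).IsSymmetricProjection where
  isIdempotentElem := LinearMap.ext fun v => by
    obtain ⟨X, rfl⟩ := hsVec.surjective v
    simp [hsMulRight_hsVec, Matrix.mul_assoc, hP.isIdempotentElem.eq]
  isSymmetric u v := by
    obtain ⟨X, rfl⟩ := hsVec.surjective u
    obtain ⟨Y, rfl⟩ := hsVec.surjective v
    rw [hsMulRight_hsVec, hsMulRight_hsVec, inner_hsVec, inner_hsVec, Matrix.conjTranspose_mul,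
      ← Matrix.star_eq_conjTranspose P, hP.isSelfAdjoint.star_eq, Matrix.mul_assoc,
      Matrix.trace_mul_comm, Matrix.mul_assoc]

end HilbertSchmidt

section LinearFactorization

variable {𝕜 E F G : Type*} [RCLike 𝕜] [AddCommGroup E] [Module 𝕜 E]
  [NormedAddCommGroup F] [NormedSpace 𝕜 F] [NormedAddCommGroup G] [InnerProductSpace 𝕜 G]
  [FiniteDimensional 𝕜 G]

lemma exists_comp_eq_of_norm_le {A : E →ₗ[𝕜] F} {B : E →ₗ[𝕜] G} {c : ℝ} (hc : 0 ≤ c)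
    (h : ∀ x, ‖A x‖ ≤ c * ‖B x‖) : ∃ K : G →ₗ[𝕜] F, K ∘ₗ B = A ∧ ∀ y, ‖K y‖ ≤ c * ‖y‖ := by
  obtain ⟨g, hg⟩ := B.rangeRestrict.exists_rightInverse_of_surjective B.range_rangeRestrict
  have hBg (y : B.range) : B (g y) = y := congrArg Subtype.val (LinearMap.congr_fun hg y)
  have hAg (x : E) : A (g (B.rangeRestrict x)) = A x := by
    rw [← sub_eq_zero, ← map_sub, ← norm_le_zero_iff]
    exact (h _).trans_eq (by simp [hBg])
  refine ⟨A ∘ₗ g ∘ₗ B.range.orthogonalProjectionOnto.toLinearMap, ?_, fun y => ?_⟩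
  · ext x
    have hproj : B.range.orthogonalProjectionOnto (B x) = B.rangeRestrict x :=
      Submodule.orthogonalProjectionOnto_mem_subspace_eq_self (B.rangeRestrict x)
    simp [hproj, hAg]
  · refine (h _).trans ?_
    gcongr
    rw [LinearMap.comp_apply, hBg]
    exact B.range.norm_orthogonalProjectionOnto_apply_le y

lemma exists_linearIsometry_comp_eq {A B : E →ₗ[𝕜] G} (h : ∀ x, ‖A x‖ = ‖B x‖) :
    ∃ U : G →ₗᵢ[𝕜] G, U.toLinearMap ∘ₗ B = A := by
  obtain ⟨K, hKB, -⟩ := exists_comp_eq_of_norm_le zero_le_one (A := A) (B := B)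
    fun x => by rw [h, one_mul]
  let K' : B.range →ₗᵢ[𝕜] G :=
    { toLinearMap := K.domRestrict B.range
      norm_map' := by
        rintro ⟨_, x, rfl⟩
        exact (congrArg norm (LinearMap.congr_fun hKB x)).trans (h x) }
  refine ⟨K'.extend, LinearMap.ext fun x => ?_⟩
  exact (K'.extend_apply ⟨B x, LinearMap.mem_range_self B x⟩).trans (LinearMap.congr_fun hKB x)

end LinearFactorization

section LoewnerOrder

variable {m n : Type*} [Fintype n]

lemma trace_re_mono {A B : Matrix n n ℂ} (h : A ≤ B) : A.trace.re ≤ B.trace.re :=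
  (Complex.le_def.1 ((Matrix.tracePositiveLinearMap n ℂ ℂ).monotone' h)).1

lemma conjTranspose_mul_mul_mono [Finite m] {A B : Matrix n n ℂ} (h : A ≤ B)
    (C : Matrix n m ℂ) :
    Cᴴ * A * C ≤ Cᴴ * B * C := by
  simpa only [Matrix.le_iff, Matrix.mul_sub, Matrix.sub_mul] using
    (Matrix.le_iff.1 h).conjTranspose_mul_mul_same C

lemma mul_mul_conjTranspose_mono [Finite m] {A B : Matrix n n ℂ} (h : A ≤ B)
    (C : Matrix m n ℂ) :
    C * A * Cᴴ ≤ C * B * Cᴴ := by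
  simpa only [Matrix.conjTranspose_conjTranspose] using conjTranspose_mul_mul_mono h Cᴴ

lemma le_trace_smul_one [DecidableEq n] {A : Matrix n n ℂ} (hA : A.PosSemidef) :
    A ≤ A.trace.re • 1 := by
  rw [← Algebra.algebraMap_eq_smul_one]
  refine (le_algebraMap_iff_spectrum_le (ha := hA.isHermitian)).2 fun x hx => ?_
  rw [hA.isHermitian.spectrum_real_eq_range_eigenvalues] at hx
  obtain ⟨i, rfl⟩ := hx
  simpa [hA.isHermitian.trace_eq_sum_eigenvalues] using
    Finset.single_le_sum (fun j _ => hA.eigenvalues_nonneg j) (Finset.mem_univ i)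

lemma exists_isStarProjection_smul_le [DecidableEq n] {H : Matrix n n ℂ} (hH : H.PosSemidef)
    {t : ℝ} (ht : 0 ≤ t) :
    ∃ P : Matrix n n ℂ, IsStarProjection P ∧ t • P ≤ H ∧ (1 - P) * H * (1 - P) ≤ t • 1 := by
  have hc (f : ℝ → ℝ) : ContinuousOn f (spectrum ℝ H) := H.finite_real_spectrum.continuousOn f
  have hsa : IsSelfAdjoint H := hH.isHermitian
  let g : ℝ → ℝ := fun x => if t ≤ x then 1 else 0
  have hcompl : 1 - cfc g H = cfc (fun x => 1 - g x) H := by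
    rw [cfc_sub _ _ _ (hc _) (hc _), cfc_const_one ℝ H]
  have hid : cfc (fun x : ℝ => x) H = H := cfc_id' ℝ H
  refine ⟨cfc g H, ⟨?_, cfc_predicate g H⟩, ?_, ?_⟩
  · rw [IsIdempotentElem, ← cfc_mul _ _ _ (hc _) (hc _)]
    congr with x
    simp [g]
  · nth_rw 2 [← hid]
    rw [← cfc_smul _ _ _ (hc _)]
    refine cfc_mono (fun x hx => ?_) (hc _) (hc _)
    have := spectrum_nonneg_of_nonneg hH.nonneg hx
    by_cases h : t ≤ x <;> simp [g, h, this]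
  · rw [hcompl]
    nth_rw 2 [← hid]
    rw [← cfc_mul _ _ _ (hc _) (hc _), ← cfc_mul _ _ _ (hc _) (hc _),
      ← Algebra.algebraMap_eq_smul_one, ← cfc_const t H]
    refine cfc_mono (fun x _ => ?_) (hc _) (hc _)
    by_cases h : t ≤ x
    · simp [g, h, ht]
    · simp [g, h, (not_le.1 h).le]

end LoewnerOrder

section OperatorNorm

open scoped Matrix.Norms.L2Operator

variable {m n k : Type*} [Fintype n] [DecidableEq n] [Fintype k]

lemma conjTranspose_mul_self_le_smul_one_iff [Fintype m] {A : Matrix m n ℂ} {r : ℝ} (hr : 0 ≤ r) :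
    Aᴴ * A ≤ r • 1 ↔ ‖A‖ ^ 2 ≤ r := by
  rw [← Algebra.algebraMap_eq_smul_one, ← CStarAlgebra.norm_le_iff_le_algebraMap _ hr
    (Matrix.posSemidef_conjTranspose_mul_self A).nonneg,
    Matrix.l2_opNorm_conjTranspose_mul_self, sq]

lemma mul_conjTranspose_le_smul_one_iff [Fintype m] [DecidableEq m] {A : Matrix m n ℂ} {r : ℝ}
    (hr : 0 ≤ r) :
    A * Aᴴ ≤ r • 1 ↔ ‖A‖ ^ 2 ≤ r := by
  simpa only [Matrix.conjTranspose_conjTranspose, Matrix.l2_opNorm_conjTranspose] using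
    conjTranspose_mul_self_le_smul_one_iff (A := Aᴴ) hr

lemma norm_toEuclideanLin_sq [Fintype m] (A : Matrix m n ℂ) (x : EuclideanSpace ℂ n) :
    ‖Matrix.toEuclideanLin A x‖ ^ 2 = (star x.ofLp ⬝ᵥ (Aᴴ * A) *ᵥ x.ofLp).re := by
  rw [norm_sq_eq_re_inner (𝕜 := ℂ), EuclideanSpace.inner_eq_star_dotProduct,
    Matrix.ofLp_toLpLin, Matrix.toLin'_apply, Matrix.star_mulVec, dotProduct_comm,
    Matrix.dotProduct_mulVec, Matrix.vecMul_vecMul, ← Matrix.dotProduct_mulVec]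
  rfl

lemma norm_toEuclideanLin_sq_le_of_le [Fintype m] {A : Matrix m n ℂ} {B : Matrix k n ℂ} {r : ℝ}
    (h : Aᴴ * A ≤ r • (Bᴴ * B)) (x : EuclideanSpace ℂ n) :
    ‖Matrix.toEuclideanLin A x‖ ^ 2 ≤ r * ‖Matrix.toEuclideanLin B x‖ ^ 2 := by
  rw [norm_toEuclideanLin_sq, norm_toEuclideanLin_sq]
  have := (Matrix.le_iff.1 h).re_dotProduct_nonneg x.ofLp
  rw [Matrix.sub_mulVec, dotProduct_sub, map_sub, Matrix.smul_mulVec, dotProduct_smul] at this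
  simpa using this

variable [Finite m]

/-- **Douglas factorization lemma**. -/
lemma exists_eq_mul_of_mul_conjTranspose_le {A : Matrix m n ℂ} {B : Matrix m k ℂ} {r : ℝ}
    (hr : 0 ≤ r) (h : A * Aᴴ ≤ r • (B * Bᴴ)) :
    ∃ K : Matrix k n ℂ, A = B * K ∧ ‖K‖ ^ 2 ≤ r := by
  classical
  have := Fintype.ofFinite m
  have hle (x : EuclideanSpace ℂ m) :
      ‖Matrix.toEuclideanLin Aᴴ x‖ ≤ √r * ‖Matrix.toEuclideanLin Bᴴ x‖ := by
    rw [← sq_le_sq₀ (norm_nonneg _) (by positivity), mul_pow, Real.sq_sqrt hr]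
    exact norm_toEuclideanLin_sq_le_of_le (by simpa using h) x
  obtain ⟨K, hKB, hK⟩ := exists_comp_eq_of_norm_le (Real.sqrt_nonneg r) hle
  obtain ⟨K, rfl⟩ := Matrix.toEuclideanLin.surjective K
  refine ⟨Kᴴ, ?_, ?_⟩
  · rw [← Matrix.toLpLin_mul (q := 2)] at hKB
    simpa using congrArg Matrix.conjTranspose (Matrix.toEuclideanLin.injective hKB).symm
  · rw [Matrix.l2_opNorm_conjTranspose, ← Real.sqrt_le_sqrt_iff hr, Real.sqrt_sq (norm_nonneg _),
      Matrix.l2_opNorm_def]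
    exact ContinuousLinearMap.opNorm_le_bound _ (Real.sqrt_nonneg r) hK

lemma exists_unitary_eq_mul_of_mul_conjTranspose_eq {A B : Matrix m n ℂ}
    (h : A * Aᴴ = B * Bᴴ) : ∃ U ∈ Matrix.unitaryGroup n ℂ, A = B * U := by
  classical
  have := Fintype.ofFinite m
  have hnorm (x : EuclideanSpace ℂ m) :
      ‖Matrix.toEuclideanLin Aᴴ x‖ = ‖Matrix.toEuclideanLin Bᴴ x‖ := by
    rw [← sq_eq_sq₀ (norm_nonneg _) (norm_nonneg _), norm_toEuclideanLin_sq,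
      norm_toEuclideanLin_sq, Matrix.conjTranspose_conjTranspose,
      Matrix.conjTranspose_conjTranspose, h]
  obtain ⟨V, hVB⟩ := exists_linearIsometry_comp_eq hnorm
  obtain ⟨U, hU⟩ := Matrix.toEuclideanLin.surjective V.toLinearMap
  refine ⟨Uᴴ, Matrix.mem_unitaryGroup_iff.2 ?_, ?_⟩
  · rw [Matrix.star_eq_conjTranspose, Matrix.conjTranspose_conjTranspose]
    apply Matrix.toEuclideanLin.injective
    rw [Matrix.toLpLin_mul (q := 2), Matrix.toEuclideanLin_conjTranspose_eq_adjoint,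
      Matrix.toLpLin_one, hU]
    refine LinearMap.ext fun x => ext_inner_left ℂ fun y => ?_
    rw [LinearMap.comp_apply, LinearMap.adjoint_inner_right]
    exact V.inner_map_map y x
  · rw [← hU, ← Matrix.toLpLin_mul (q := 2)] at hVB
    simpa using congrArg Matrix.conjTranspose (Matrix.toEuclideanLin.injective hVB).symm

end OperatorNorm

section TraceNorm

open scoped Matrix.Norms.L2Operator

variable {m n k : Type*} [Fintype m] [Fintype n]

lemma norm_hsVec_mul_le [Fintype k] [DecidableEq k] (X : Matrix m n ℂ) (V : Matrix n k ℂ) :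
    ‖hsVec (X * V)‖ ≤ ‖V‖ * ‖hsVec X‖ := by
  classical
  rw [← sq_le_sq₀ (norm_nonneg _) (by positivity), mul_pow,
    norm_hsVec_sq_eq_trace_mul_conjTranspose, norm_hsVec_sq_eq_trace_mul_conjTranspose]
  have hV := mul_mul_conjTranspose_mono
    ((mul_conjTranspose_le_smul_one_iff (A := V) (by positivity)).2 le_rfl) X
  simpa only [Matrix.mul_assoc, Matrix.conjTranspose_mul, Matrix.mul_smul, Matrix.smul_mul,
    Matrix.one_mul, Matrix.trace_smul, Complex.smul_re, smul_eq_mul] using trace_re_mono hV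

variable [DecidableEq n]

lemma posSemidef_sqrt (A : Matrix n n ℂ) : (CFC.sqrt A).PosSemidef :=
  Matrix.nonneg_iff_posSemidef.1 (CFC.sqrt_nonneg A)

lemma conjTranspose_sqrt (A : Matrix n n ℂ) : (CFC.sqrt A)ᴴ = CFC.sqrt A :=
  (posSemidef_sqrt A).isHermitian

lemma sqrt_mul_conjTranspose_sqrt {A : Matrix n n ℂ} (hA : A.PosSemidef) :
    CFC.sqrt A * (CFC.sqrt A)ᴴ = A := by
  rw [conjTranspose_sqrt, CFC.sqrt_mul_sqrt_self A hA.nonneg]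

lemma norm_hsVec_sqrt_sq {A : Matrix n n ℂ} (hA : A.PosSemidef) :
    ‖hsVec (CFC.sqrt A)‖ ^ 2 = A.trace.re := by
  rw [norm_hsVec_sq_eq_trace_mul_conjTranspose, sqrt_mul_conjTranspose_sqrt hA]

lemma norm_trace_mul_le_of_posSemidef {H : Matrix n n ℂ} (hH : H.PosSemidef)
    (V : Matrix n n ℂ) : ‖(H * V).trace‖ ≤ ‖V‖ * H.trace.re := by
  have hinner : (H * V).trace = inner ℂ (hsVec (CFC.sqrt H)) (hsVec (CFC.sqrt H * V)) := by
    rw [inner_hsVec, conjTranspose_sqrt, ← Matrix.mul_assoc, CFC.sqrt_mul_sqrt_self H hH.nonneg]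
  rw [hinner, ← norm_hsVec_sqrt_sq hH, sq, ← mul_assoc, mul_comm]
  exact (norm_inner_le_norm _ _).trans (by gcongr; exact norm_hsVec_mul_le _ V)

/-- **Polar decomposition**. -/
lemma exists_unitary_eq_mul_sqrt (X : Matrix n n ℂ) :
    ∃ U ∈ Matrix.unitaryGroup n ℂ, X = U * CFC.sqrt (Xᴴ * X) := by
  obtain ⟨U, hU, hXU⟩ := exists_unitary_eq_mul_of_mul_conjTranspose_eq (A := Xᴴ)
    (B := CFC.sqrt (Xᴴ * X)) (by
      rw [sqrt_mul_conjTranspose_sqrt (Matrix.posSemidef_conjTranspose_mul_self X),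
        Matrix.conjTranspose_conjTranspose])
  refine ⟨Uᴴ, Unitary.star_mem hU, ?_⟩
  simpa [conjTranspose_sqrt] using congrArg Matrix.conjTranspose hXU

lemma norm_trace_mul_le_traceNorm (X V : Matrix n n ℂ) :
    ‖(X * V).trace‖ ≤ ‖V‖ * traceNorm X := by
  obtain ⟨U, hU, hXU⟩ := exists_unitary_eq_mul_sqrt X
  have htrace : (X * V).trace = (CFC.sqrt (Xᴴ * X) * (V * U)).trace := by
    rw [← Matrix.mul_assoc, Matrix.trace_mul_comm _ U, ← Matrix.mul_assoc, ← hXU]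
  rw [htrace, traceNorm, ← CStarRing.norm_mul_mem_unitary V hU]
  exact norm_trace_mul_le_of_posSemidef (posSemidef_sqrt _) _

lemma exists_unitary_trace_mul_eq_traceNorm (X : Matrix n n ℂ) :
    ∃ U ∈ Matrix.unitaryGroup n ℂ, (X * U).trace = traceNorm X := by
  obtain ⟨U, hU, hXU⟩ := exists_unitary_eq_mul_sqrt X
  refine ⟨star U, Unitary.star_mem hU, ?_⟩
  rw [Matrix.trace_mul_comm]
  nth_rw 1 [hXU]
  rw [← Matrix.mul_assoc, Matrix.mem_unitaryGroup_iff'.1 hU, Matrix.one_mul, traceNorm]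
  exact (Complex.eq_re_of_ofReal_le (posSemidef_sqrt (Xᴴ * X)).trace_nonneg)

end TraceNorm

section Fidelity

open scoped Matrix.Norms.L2Operator

variable {m n k : Type*} [Fintype m] [Fintype n] [DecidableEq n] [Fintype k]

lemma fidelity_nonneg (ρ σ : Matrix n n ℂ) : 0 ≤ fidelity ρ σ :=
  (Complex.le_def.1 (posSemidef_sqrt _).trace_nonneg).1

lemma fidelity_self {ρ : Matrix n n ℂ} (hρ : ρ.PosSemidef) : fidelity ρ ρ = ρ.trace.re := by
  rw [fidelity, traceNorm, CFC.sqrt_mul_sqrt_self ρ hρ.nonneg, hρ.isHermitian,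
    CFC.sqrt_mul_self ρ hρ.nonneg]

lemma fidelity_sq_le_of_le_smul {r : ℝ} (hr : 0 ≤ r) (ρ : Matrix n n ℂ) {σ τ : Matrix n n ℂ}
    (hσ : σ.PosSemidef) (hτ : τ.PosSemidef) (h : σ ≤ r • τ) :
    fidelity ρ σ ^ 2 ≤ r * fidelity ρ τ ^ 2 := by
  obtain ⟨K, hK, hKr⟩ := exists_eq_mul_of_mul_conjTranspose_le (A := CFC.sqrt σ)
    (B := CFC.sqrt τ) hr (by rwa [sqrt_mul_conjTranspose_sqrt hσ, sqrt_mul_conjTranspose_sqrt hτ])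
  obtain ⟨U, hU, hUF⟩ := exists_unitary_trace_mul_eq_traceNorm (CFC.sqrt ρ * CFC.sqrt σ)
  have hF : fidelity ρ σ ≤ ‖K‖ * fidelity ρ τ := by
    have hbound := norm_trace_mul_le_traceNorm (CFC.sqrt ρ * CFC.sqrt τ) (K * U)
    rw [← Matrix.mul_assoc, Matrix.mul_assoc (CFC.sqrt ρ), ← hK, hUF,
      CStarRing.norm_mul_mem_unitary K hU] at hbound
    rwa [Complex.norm_real, ← fidelity, ← fidelity, Real.norm_of_nonneg (fidelity_nonneg ρ σ)]
      at hbound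
  calc fidelity ρ σ ^ 2 ≤ (‖K‖ * fidelity ρ τ) ^ 2 := by gcongr; exact fidelity_nonneg ρ σ
    _ = ‖K‖ ^ 2 * fidelity ρ τ ^ 2 := mul_pow _ _ 2
    _ ≤ r * fidelity ρ τ ^ 2 := by gcongr

lemma exists_eq_sqrt_mul [DecidableEq m] (R : Matrix n m ℂ) :
    ∃ K : Matrix n m ℂ, R = CFC.sqrt (R * Rᴴ) * K ∧ ‖K‖ ≤ 1 := by
  obtain ⟨K, hRK, hK⟩ := exists_eq_mul_of_mul_conjTranspose_le (A := R)
    (B := CFC.sqrt (R * Rᴴ)) zero_le_one (by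
      rw [sqrt_mul_conjTranspose_sqrt (Matrix.posSemidef_self_mul_conjTranspose R), one_smul])
  exact ⟨K, hRK, (sq_le_one_iff₀ (norm_nonneg K)).1 hK⟩

lemma norm_trace_le_norm_mul_fidelity [DecidableEq m] (R : Matrix n m ℂ)
    (S : Matrix n k ℂ) (V : Matrix k m ℂ) :
    ‖(Rᴴ * S * V).trace‖ ≤ ‖V‖ * fidelity (R * Rᴴ) (S * Sᴴ) := by
  classical
  obtain ⟨K, hRK, hK⟩ := exists_eq_sqrt_mul R
  obtain ⟨L, hSL, hL⟩ := exists_eq_sqrt_mul S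
  have htrace : (Rᴴ * S * V).trace
      = (CFC.sqrt (R * Rᴴ) * CFC.sqrt (S * Sᴴ) * (L * V * Kᴴ)).trace := by
    calc (Rᴴ * S * V).trace
        = ((CFC.sqrt (R * Rᴴ) * K)ᴴ * (CFC.sqrt (S * Sᴴ) * L) * V).trace := by rw [← hRK, ← hSL]
      _ = _ := by
          rw [Matrix.conjTranspose_mul, conjTranspose_sqrt, Matrix.mul_assoc, Matrix.mul_assoc,
            Matrix.trace_mul_comm]
          simp only [Matrix.mul_assoc]
  have hnorm : ‖L * V * Kᴴ‖ ≤ ‖V‖ :=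
    calc ‖L * V * Kᴴ‖ ≤ ‖L‖ * ‖V‖ * ‖K‖ := by
          rw [← Matrix.l2_opNorm_conjTranspose K]
          exact (Matrix.l2_opNorm_mul _ _).trans (by gcongr; exact Matrix.l2_opNorm_mul L V)
      _ ≤ 1 * ‖V‖ * 1 := by gcongr
      _ = ‖V‖ := by ring
  rw [htrace]
  exact (norm_trace_mul_le_traceNorm _ _).trans (by gcongr; exacts [fidelity_nonneg _ _, le_rfl])

/-- **Uhlmann's theorem**. -/
lemma exists_purification_trace_eq_fidelity {ρ : Matrix n n ℂ} (hρ : ρ.PosSemidef)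
    (R : Matrix n n ℂ) :
    ∃ S : Matrix n n ℂ, S * Sᴴ = ρ ∧ (Sᴴ * R).trace = fidelity ρ (R * Rᴴ) := by
  obtain ⟨V, hV, hRV⟩ := exists_unitary_eq_mul_of_mul_conjTranspose_eq (A := R)
    (B := CFC.sqrt (R * Rᴴ))
    (sqrt_mul_conjTranspose_sqrt (Matrix.posSemidef_self_mul_conjTranspose R)).symm
  obtain ⟨U, hU, hUF⟩ := exists_unitary_trace_mul_eq_traceNorm (CFC.sqrt ρ * CFC.sqrt (R * Rᴴ))
  have hVV : V * Vᴴ = 1 := Matrix.mem_unitaryGroup_iff.1 hV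
  have hUU : Uᴴ * U = 1 := Matrix.mem_unitaryGroup_iff'.1 hU
  refine ⟨CFC.sqrt ρ * Uᴴ * V, ?_, ?_⟩
  · calc CFC.sqrt ρ * Uᴴ * V * (CFC.sqrt ρ * Uᴴ * V)ᴴ
        = CFC.sqrt ρ * (Uᴴ * (V * Vᴴ) * U) * (CFC.sqrt ρ)ᴴ := by
          simp only [Matrix.conjTranspose_mul, Matrix.conjTranspose_conjTranspose, Matrix.mul_assoc]
      _ = ρ := by
          rw [hVV, Matrix.mul_one, hUU, Matrix.mul_one, sqrt_mul_conjTranspose_sqrt hρ]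
  · have hRVH : R * Vᴴ = CFC.sqrt (R * Rᴴ) := by
      nth_rw 1 [hRV]
      rw [Matrix.mul_assoc, hVV, Matrix.mul_one]
    calc ((CFC.sqrt ρ * Uᴴ * V)ᴴ * R).trace
        = (Vᴴ * U * (CFC.sqrt ρ * R)).trace := by
          simp only [Matrix.conjTranspose_mul, Matrix.conjTranspose_conjTranspose,
            conjTranspose_sqrt, Matrix.mul_assoc]
      _ = (CFC.sqrt ρ * (R * Vᴴ) * U).trace := by
          rw [Matrix.trace_mul_comm]
          simp only [Matrix.mul_assoc]
      _ = fidelity ρ (R * Rᴴ) := by rw [hRVH, hUF, fidelity]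

lemma purifiedDist_le_pureDist (R S : Matrix n m ℂ) :
    purifiedDist (R * Rᴴ) (S * Sᴴ) ≤ pureDist (hsVec R) (hsVec S) := by
  classical
  have hinner : ‖inner ℂ (hsVec R) (hsVec S)‖ ≤ fidelity (R * Rᴴ) (S * Sᴴ) := by
    have hone : ‖(1 : Matrix m m ℂ)‖ ≤ 1 := IsStarProjection.norm_le _ (.one _)
    have htrace := norm_trace_le_norm_mul_fidelity R S 1
    rw [Matrix.mul_one, ← inner_hsVec] at htrace
    exact htrace.trans (mul_le_of_le_one_left (fidelity_nonneg _ _) hone)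
  have hle : pureFidelity (hsVec R) (hsVec S) ≤ genFidelity (R * Rᴴ) (S * Sᴴ) := by
    rw [pureFidelity, genFidelity, norm_hsVec_sq_eq_trace_mul_conjTranspose,
      norm_hsVec_sq_eq_trace_mul_conjTranspose]
    gcongr
  have hnonneg := pureFidelity_nonneg (hsVec R) (hsVec S)
  exact Real.sqrt_le_sqrt (by gcongr)

lemma exists_purification_pureDist_eq {ρ : Matrix n n ℂ} (hρ : ρ.PosSemidef)
    (R : Matrix n n ℂ) :
    ∃ S : Matrix n n ℂ, S * Sᴴ = ρ ∧
      pureDist (hsVec S) (hsVec R) = purifiedDist ρ (R * Rᴴ) := by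
  obtain ⟨S, rfl, hSR⟩ := exists_purification_trace_eq_fidelity hρ R
  refine ⟨S, rfl, ?_⟩
  rw [pureDist, purifiedDist, pureFidelity, genFidelity,
    norm_hsVec_sq_eq_trace_mul_conjTranspose, norm_hsVec_sq_eq_trace_mul_conjTranspose,
    inner_hsVec, hSR, Complex.norm_real, Real.norm_of_nonneg (fidelity_nonneg _ _)]

lemma mem_closeStates_self {ρ : Matrix n n ℂ} (hρ : IsSubState ρ) {ε : ℝ} (hε : 0 ≤ ε) :
    ρ ∈ closeStates ε ρ := by
  have h : 0 ≤ 1 - ρ.trace.re := sub_nonneg.2 hρ.2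
  refine ⟨hρ, ?_⟩
  simpa [purifiedDist, genFidelity, fidelity_self hρ.1, Real.sqrt_mul_self h] using hε

end Fidelity

section Relabelling

variable {m n : Type*} [Fintype m] [Fintype n]

lemma trace_submatrix_equiv (A : Matrix n n ℂ) (e : m ≃ n) :
    (A.submatrix e e).trace = A.trace :=
  e.sum_comp fun i => A i i

variable [DecidableEq m] [DecidableEq n]

lemma sqrt_submatrix_equiv {A : Matrix n n ℂ} (hA : A.PosSemidef) (e : m ≃ n) :
    CFC.sqrt (A.submatrix e e) = (CFC.sqrt A).submatrix e e := by
  refine CFC.sqrt_unique ?_ ((posSemidef_sqrt A).submatrix e).nonneg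
  rw [Matrix.submatrix_mul_equiv, CFC.sqrt_mul_sqrt_self A hA.nonneg]

lemma traceNorm_submatrix_equiv (X : Matrix n n ℂ) (e : m ≃ n) :
    traceNorm (X.submatrix e e) = traceNorm X := by
  rw [traceNorm, Matrix.conjTranspose_submatrix, Matrix.submatrix_mul_equiv,
    sqrt_submatrix_equiv (Matrix.posSemidef_conjTranspose_mul_self X), trace_submatrix_equiv,
    traceNorm]

lemma purifiedDist_submatrix_equiv {ρ σ : Matrix n n ℂ} (hρ : ρ.PosSemidef) (hσ : σ.PosSemidef)
    (e : m ≃ n) : purifiedDist (ρ.submatrix e e) (σ.submatrix e e) = purifiedDist ρ σ := by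
  simp only [purifiedDist, genFidelity, fidelity, sqrt_submatrix_equiv hρ, sqrt_submatrix_equiv hσ,
    Matrix.submatrix_mul_equiv, traceNorm_submatrix_equiv, trace_submatrix_equiv]

lemma submatrix_mem_closeStates {ε : ℝ} {ρ σ : Matrix n n ℂ} (hσ : σ.PosSemidef)
    (h : ρ ∈ closeStates ε σ) (e : m ≃ n) :
    ρ.submatrix e e ∈ closeStates ε (σ.submatrix e e) :=
  ⟨⟨h.1.1.submatrix e, (trace_submatrix_equiv ρ e).symm ▸ h.1.2⟩,
    (purifiedDist_submatrix_equiv h.1.1 hσ e).trans_le h.2⟩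

end Relabelling

section Fold

variable {a β γ d : Type*}

/-- Moves the first tensor factor from the row index to the column index. If `R` purifies a state
on `a × β`, with purifying system `d`, then `foldFst R` purifies its marginal on `β`, with
purifying system `a × d`. -/
def foldFst : Matrix (a × β) d ℂ ≃ Matrix β (a × d) ℂ where
  toFun R := Matrix.of fun i p => R (p.1, i) p.2
  invFun X := Matrix.of fun p j => X p.2 (p.1, j)
  left_inv _ := rfl
  right_inv _ := rfl

lemma foldFst_apply (R : Matrix (a × β) d ℂ) (i : β) (p : a × d) :
    foldFst R i p = R (p.1, i) p.2 := rfl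

variable [Fintype a]

lemma foldFst_one_kronecker_mul [DecidableEq a] [Fintype β] (B : Matrix γ β ℂ)
    (R : Matrix (a × β) d ℂ) :
    foldFst (((1 : Matrix a a ℂ) ⊗ₖ B) * R) = B * foldFst R := by
  ext i p
  simp [foldFst_apply, Matrix.mul_apply, Fintype.sum_prod_type, Matrix.one_apply]

lemma traceFst_mul_conjTranspose [Fintype d] (R : Matrix (a × β) d ℂ) :
    traceFst (R * Rᴴ) = foldFst R * (foldFst R)ᴴ := by
  ext i j
  simp [traceFst, foldFst_apply, Matrix.mul_apply, Fintype.sum_prod_type]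

lemma traceFst_conjTranspose_foldFst_mul [Fintype β] (R : Matrix (a × β) d ℂ) :
    traceFst ((foldFst R)ᴴ * foldFst R) = Rᴴ * R := by
  ext i j
  simp [traceFst, foldFst_apply, Matrix.mul_apply, Fintype.sum_prod_type]

lemma inner_hsVec_foldFst [Fintype β] [Fintype d] (R S : Matrix (a × β) d ℂ) :
    inner ℂ (hsVec (foldFst R)) (hsVec (foldFst S)) = inner ℂ (hsVec R) (hsVec S) := by
  rw [inner_hsVec, inner_hsVec]
  simp only [Matrix.trace, Matrix.diag, Matrix.mul_apply, Matrix.conjTranspose_apply, foldFst_apply,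
    Fintype.sum_prod_type]
  exact Finset.sum_comm

lemma norm_hsVec_foldFst [Fintype β] [Fintype d] (R : Matrix (a × β) d ℂ) :
    ‖hsVec (foldFst R)‖ = ‖hsVec R‖ := by
  rw [norm_eq_sqrt_re_inner (𝕜 := ℂ), inner_hsVec_foldFst, ← norm_eq_sqrt_re_inner]

lemma pureDist_hsVec_foldFst [Fintype β] [Fintype d] (R S : Matrix (a × β) d ℂ) :
    pureDist (hsVec (foldFst R)) (hsVec (foldFst S)) = pureDist (hsVec R) (hsVec S) := by
  simp only [pureDist, pureFidelity, inner_hsVec_foldFst, norm_hsVec_foldFst]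

lemma traceFst_mono {X Y : Matrix (a × β) (a × β) ℂ} (h : X ≤ Y) : traceFst X ≤ traceFst Y := by
  have hsub : traceFst Y - traceFst X
      = ∑ k : a, (Y - X).submatrix (fun i : β => (k, i)) (fun i => (k, i)) := by
    ext i j
    simp [traceFst, Matrix.sum_apply]
  rw [Matrix.le_iff, hsub]
  exact Matrix.posSemidef_sum _ fun k _ => (Matrix.le_iff.1 h).submatrix _

lemma traceFst_smul (r : ℝ) (X : Matrix (a × β) (a × β) ℂ) :
    traceFst (r • X) = r • traceFst X := by
  ext i j
  simp [traceFst, Finset.mul_sum]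

section StarProjection

variable [Fintype β] {P : Matrix (a × β) (a × β) ℂ}

lemma conjTranspose_foldFst_symm_mul_self (hP : IsStarProjection P) :
    (foldFst.symm P)ᴴ * foldFst.symm P = traceFst P := by
  rw [← traceFst_conjTranspose_foldFst_mul, Equiv.apply_symm_apply, ← Matrix.star_eq_conjTranspose,
    hP.isSelfAdjoint.star_eq, hP.isIdempotentElem.eq]

lemma one_kronecker_mul_foldFst_symm [DecidableEq a] (hP : IsStarProjection P)
    (T : Matrix γ (a × β) ℂ) :
    ((1 : Matrix a a ℂ) ⊗ₖ (T * P)) * foldFst.symm P = foldFst.symm (T * P) := by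
  rw [Equiv.eq_symm_apply, foldFst_one_kronecker_mul, Equiv.apply_symm_apply, Matrix.mul_assoc,
    hP.isIdempotentElem.eq]

end StarProjection

end Fold

section ChainRule

open scoped Matrix.Norms.L2Operator

lemma one_kronecker_mul_conjTranspose {a β γ : Type*} [Fintype a] [DecidableEq a] [Fintype γ]
    (B : Matrix β γ ℂ) :
    ((1 : Matrix a a ℂ) ⊗ₖ B) * ((1 : Matrix a a ℂ) ⊗ₖ B)ᴴ = (1 : Matrix a a ℂ) ⊗ₖ (B * Bᴴ) := by
  rw [Matrix.conjTranspose_kronecker, ← Matrix.mul_kronecker_mul, Matrix.conjTranspose_one,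
    Matrix.mul_one]

lemma exists_isStarProjection_norm_sub_mul_le {m k n : Type*} [Fintype m] [Fintype k] [Fintype n]
    (Q : Matrix m k ℂ) (N : Matrix k n ℂ) {δ : ℝ} (hδ : 0 ≤ δ) :
    ∃ P : Matrix n n ℂ, IsStarProjection P ∧ δ • P ≤ Nᴴ * N ∧
      ‖hsVec (Q * N) - hsVec (Q * N * P)‖ ^ 2 ≤ δ * (Q * Qᴴ).trace.re := by
  classical
  obtain ⟨P, hP, hle, hcompl⟩ :=
    exists_isStarProjection_smul_le (Matrix.posSemidef_conjTranspose_mul_self N) hδ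
  refine ⟨P, hP, hle, ?_⟩
  have hnorm : ‖N * (1 - P)‖ ^ 2 ≤ δ := by
    rw [← conjTranspose_mul_self_le_smul_one_iff hδ, Matrix.conjTranspose_mul,
      ← Matrix.star_eq_conjTranspose (1 - P), hP.one_sub.isSelfAdjoint.star_eq]
    simpa only [Matrix.mul_assoc] using hcompl
  calc ‖hsVec (Q * N) - hsVec (Q * N * P)‖ ^ 2 = ‖hsVec (Q * (N * (1 - P)))‖ ^ 2 := by
        rw [← map_sub, Matrix.mul_sub, Matrix.mul_one, Matrix.mul_sub, Matrix.mul_assoc]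
    _ ≤ (‖N * (1 - P)‖ * ‖hsVec Q‖) ^ 2 := by gcongr; exact norm_hsVec_mul_le _ _
    _ = ‖N * (1 - P)‖ ^ 2 * (Q * Qᴴ).trace.re := by
        rw [mul_pow, norm_hsVec_sq_eq_trace_mul_conjTranspose]
    _ ≤ δ * (Q * Qᴴ).trace.re := by
        gcongr
        exact (Complex.le_def.1 (Matrix.posSemidef_self_mul_conjTranspose Q).trace_nonneg).1

variable {a b c d e β : Type*} [Fintype a] [DecidableEq a] [Fintype b] [DecidableEq b]
  [Fintype d] [DecidableEq d] [Fintype e] [Fintype β]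

lemma exists_foldFst_foldFst_eq_mul [Finite c] {R : Matrix (a × b × c) d ℂ} {Q : Matrix c e ℂ}
    {r : ℝ} (hr : 0 ≤ r)
    (h : R * Rᴴ ≤ r • ((1 : Matrix a a ℂ) ⊗ₖ ((1 : Matrix b b ℂ) ⊗ₖ (Q * Qᴴ)))) :
    ∃ N : Matrix e (b × a × d) ℂ, foldFst (foldFst R) = Q * N ∧
      traceFst (traceFst (Nᴴ * N)) ≤ r • 1 := by
  rw [← one_kronecker_mul_conjTranspose, ← one_kronecker_mul_conjTranspose] at h
  obtain ⟨K, rfl, hK⟩ := exists_eq_mul_of_mul_conjTranspose_le hr h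
  refine ⟨foldFst (foldFst K), ?_, ?_⟩
  · rw [foldFst_one_kronecker_mul, foldFst_one_kronecker_mul]
  · rw [traceFst_conjTranspose_foldFst_mul, traceFst_conjTranspose_foldFst_mul]
    exact (conjTranspose_mul_self_le_smul_one_iff hr).2 hK

lemma exists_isStarProjection_of_le_kronecker [Fintype c] {R : Matrix (a × b × c) d ℂ}
    {σ : Matrix c c ℂ} (hσ : σ.PosSemidef) {r δ : ℝ} (hr : 0 ≤ r) (hδ : 0 ≤ δ)
    (h : R * Rᴴ ≤ r • ((1 : Matrix a a ℂ) ⊗ₖ ((1 : Matrix b b ℂ) ⊗ₖ σ))) :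
    ∃ P : Matrix (b × a × d) (b × a × d) ℂ, IsStarProjection P ∧
      δ • traceFst (traceFst P) ≤ r • 1 ∧
      ‖hsVec (foldFst (foldFst R)) - hsVec (foldFst (foldFst R) * P)‖ ^ 2 ≤ δ * σ.trace.re := by
  classical
  rw [← sqrt_mul_conjTranspose_sqrt hσ] at h ⊢
  obtain ⟨N, hRN, hN⟩ := exists_foldFst_foldFst_eq_mul hr h
  obtain ⟨P, hP, hle, hnorm⟩ := exists_isStarProjection_norm_sub_mul_le (CFC.sqrt σ) N hδ
  refine ⟨P, hP, ?_, hRN ▸ hnorm⟩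
  rw [← traceFst_smul, ← traceFst_smul]
  exact (traceFst_mono (traceFst_mono hle)).trans hN

lemma foldFst_symm_mul_mul_conjTranspose_le [Finite c] {T : Matrix c (b × e) ℂ}
    {P : Matrix (b × e) (b × e) ℂ} (hP : IsStarProjection P) {Y : Matrix e d ℂ} {s : ℝ}
    (hs : 0 ≤ s) (h : Yᴴ * traceFst P * Y ≤ s • 1) :
    (foldFst.symm (T * P) * Y) * (foldFst.symm (T * P) * Y)ᴴ
      ≤ s • ((1 : Matrix b b ℂ) ⊗ₖ (T * P * (T * P)ᴴ)) := by
  classical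
  have hnorm : (foldFst.symm P * Y)ᴴ * (foldFst.symm P * Y) ≤ s • 1 := by
    rw [← conjTranspose_foldFst_symm_mul_self hP] at h
    simpa only [Matrix.conjTranspose_mul, Matrix.mul_assoc] using h
  rw [conjTranspose_mul_self_le_smul_one_iff hs, ← mul_conjTranspose_le_smul_one_iff hs] at hnorm
  have hle := mul_mul_conjTranspose_mono hnorm ((1 : Matrix b b ℂ) ⊗ₖ (T * P))
  rw [Matrix.mul_smul, Matrix.mul_one, Matrix.smul_mul, one_kronecker_mul_conjTranspose] at hle
  rw [← one_kronecker_mul_foldFst_symm hP]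
  simpa only [Matrix.conjTranspose_mul, Matrix.mul_assoc] using hle

variable [DecidableEq β]

lemma norm_hsVec_foldFst_mul_sq_le_sqrt_mul_fidelity (R : Matrix (a × β) d ℂ)
    {E : Matrix (a × d) (a × d) ℂ} (hE : IsStarProjection E) {r : ℝ} (hr : 0 ≤ r)
    (h : traceFst E ≤ r • 1) :
    ‖hsVec (foldFst R * E)‖ ^ 2 ≤ √r * fidelity (R * Rᴴ)
      ((1 : Matrix a a ℂ) ⊗ₖ (foldFst R * E * (foldFst R * E)ᴴ)) := by
  have hnorm : ‖foldFst.symm E‖ ≤ √r := by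
    rw [← conjTranspose_foldFst_symm_mul_self hE, conjTranspose_mul_self_le_smul_one_iff hr] at h
    exact Real.le_sqrt_of_sq_le h
  have hinner : (Rᴴ * ((1 : Matrix a a ℂ) ⊗ₖ (foldFst R * E)) * foldFst.symm E).trace
      = (‖hsVec (foldFst R * E)‖ ^ 2 : ℝ) := by
    have hproj := isSymmetricProjection_hsMulRight (m := β) hE
    rw [Matrix.mul_assoc, one_kronecker_mul_foldFst_symm hE, ← inner_hsVec, ← inner_hsVec_foldFst,
      Equiv.apply_symm_apply, ← hsMulRight_hsVec, ← hproj.isSymmetric,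
      inner_map_self_eq_norm_sq hproj]
    exact (Complex.ofReal_pow _ 2).symm
  have hF := norm_trace_le_norm_mul_fidelity R ((1 : Matrix a a ℂ) ⊗ₖ (foldFst R * E))
    (foldFst.symm E)
  rw [hinner, one_kronecker_mul_conjTranspose, Complex.norm_real,
    Real.norm_of_nonneg (sq_nonneg _)] at hF
  exact hF.trans (by gcongr; exact fidelity_nonneg _ _)

lemma fidelity_one_kronecker_sq_le {ρ : Matrix (a × β) (a × β) ℂ} {M : ℝ}
    (h : ∀ τ : Matrix β β ℂ, IsSubState τ → fidelity ρ ((1 : Matrix a a ℂ) ⊗ₖ τ) ^ 2 ≤ M)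
    {σ : Matrix β β ℂ} (hσ : σ.PosSemidef) :
    fidelity ρ ((1 : Matrix a a ℂ) ⊗ₖ σ) ^ 2 ≤ σ.trace.re * M := by
  have htr : 0 ≤ σ.trace.re := (Complex.le_def.1 hσ.trace_nonneg).1
  set τ := σ.trace.re⁻¹ • σ with hτ
  have hτσ : σ = σ.trace.re • τ := by
    rcases htr.eq_or_lt with h0 | hpos
    · have hσ0 : σ = 0 := hσ.trace_eq_zero_iff.1
        (Complex.ext h0.symm (Complex.le_def.1 hσ.trace_nonneg).2.symm)
      simp [hτ, hσ0]
    · rw [hτ, smul_smul, mul_inv_cancel₀ hpos.ne', one_smul]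
  have hτsub : IsSubState τ := by
    refine ⟨hσ.smul (inv_nonneg.2 htr), ?_⟩
    rw [hτ, Matrix.trace_smul, Complex.smul_re, smul_eq_mul]
    exact inv_mul_le_one
  have hkron (X : Matrix β β ℂ) (hX : X.PosSemidef) : ((1 : Matrix a a ℂ) ⊗ₖ X).PosSemidef :=
    Matrix.PosSemidef.one.kronecker hX
  have hle : (1 : Matrix a a ℂ) ⊗ₖ σ ≤ σ.trace.re • ((1 : Matrix a a ℂ) ⊗ₖ τ) := by
    rw [← Matrix.kronecker_smul, ← hτσ]
  calc fidelity ρ ((1 : Matrix a a ℂ) ⊗ₖ σ) ^ 2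
      ≤ σ.trace.re * fidelity ρ ((1 : Matrix a a ℂ) ⊗ₖ τ) ^ 2 :=
        fidelity_sq_le_of_le_smul htr ρ (hkron σ hσ) (hkron τ hτsub.1) hle
    _ ≤ σ.trace.re * M := by gcongr; exact h τ hτsub

lemma norm_hsVec_foldFst_mul_sq_le (R : Matrix (a × β) d ℂ) {E : Matrix (a × d) (a × d) ℂ}
    (hE : IsStarProjection E) {r M : ℝ} (hr : 0 ≤ r) (hM : 0 ≤ M) (hEr : traceFst E ≤ r • 1)
    (h : ∀ τ : Matrix β β ℂ, IsSubState τ →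
      fidelity (R * Rᴴ) ((1 : Matrix a a ℂ) ⊗ₖ τ) ^ 2 ≤ M) :
    ‖hsVec (foldFst R * E)‖ ^ 2 ≤ r * M := by
  set w := ‖hsVec (foldFst R * E)‖ ^ 2 with hw
  have hw₀ : 0 ≤ w := sq_nonneg _
  have hF := fidelity_one_kronecker_sq_le h
    (Matrix.posSemidef_self_mul_conjTranspose (foldFst R * E))
  rw [← norm_hsVec_sq_eq_trace_mul_conjTranspose, ← hw] at hF
  have hw_sq : w * w ≤ r * M * w :=
    calc w * w = w ^ 2 := (sq w).symm
      _ ≤ (√r * fidelity (R * Rᴴ)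
            ((1 : Matrix a a ℂ) ⊗ₖ (foldFst R * E * (foldFst R * E)ᴴ))) ^ 2 := by
          gcongr
          exact norm_hsVec_foldFst_mul_sq_le_sqrt_mul_fidelity R hE hr hEr
      _ ≤ r * (w * M) := by rw [mul_pow, Real.sq_sqrt hr]; gcongr
      _ = r * M * w := by ring
  rcases hw₀.eq_or_lt with h0 | hpos
  · rw [← h0]; positivity
  · exact le_of_mul_le_mul_right hw_sq hpos

lemma exists_isStarProjection_of_fidelity_le (R : Matrix (a × β) d ℂ)
    {Y : Matrix (a × d) (a × d) ℂ} (hY : Y.PosSemidef) {q s M : ℝ} (hq : 0 ≤ q) (hs : 0 < s)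
    (hM : 0 ≤ M) (hYq : traceFst Y ≤ q • 1)
    (h : ∀ τ : Matrix β β ℂ, IsSubState τ →
      fidelity (R * Rᴴ) ((1 : Matrix a a ℂ) ⊗ₖ τ) ^ 2 ≤ M) :
    ∃ E : Matrix (a × d) (a × d) ℂ, IsStarProjection E ∧ (1 - E) * Y * (1 - E) ≤ s • 1 ∧
      s * ‖hsVec (foldFst R * E)‖ ^ 2 ≤ q * M := by
  obtain ⟨E, hE, hEY, hcompl⟩ := exists_isStarProjection_smul_le hY hs.le
  refine ⟨E, hE, hcompl, ?_⟩
  have hEq : traceFst E ≤ (s⁻¹ * q) • 1 := by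
    have htrace := (traceFst_mono hEY).trans hYq
    rwa [traceFst_smul, ← le_inv_smul_iff_of_pos hs, smul_smul] at htrace
  rw [← le_inv_mul_iff₀ hs, ← mul_assoc]
  exact norm_hsVec_foldFst_mul_sq_le R hE (by positivity) hM hEq h

end ChainRule

section PurifiedChainRule

lemma one_sub_sqrt_one_sub_sq_pos {ε : ℝ} (hε : 0 < ε) : 0 < 1 - √(1 - ε ^ 2) := by
  rw [sub_pos, Real.sqrt_lt' one_pos]
  linarith [pow_pos hε 2]

lemma submatrix_prodAssoc_symm_le {a b c : Type*} [DecidableEq a] [DecidableEq b] [Finite c]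
    {ρ : Matrix ((a × b) × c) ((a × b) × c) ℂ} {σ : Matrix c c ℂ} {r : ℝ}
    (h : ρ ≤ r • ((1 : Matrix (a × b) (a × b) ℂ) ⊗ₖ σ)) :
    ρ.submatrix (Equiv.prodAssoc a b c).symm (Equiv.prodAssoc a b c).symm
      ≤ r • ((1 : Matrix a a ℂ) ⊗ₖ ((1 : Matrix b b ℂ) ⊗ₖ σ)) := by
  rw [← Matrix.kronecker_assoc', Matrix.one_kronecker_one]
  exact (Matrix.le_iff.1 h).submatrix _

variable {a b c d β : Type*} [Fintype a] [DecidableEq a] [Fintype b] [DecidableEq b]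
  [Fintype d] [Fintype β]

lemma exists_isStarProjection_pureDist_le_of_le_kronecker [Fintype c] [DecidableEq d]
    {R : Matrix (a × b × c) d ℂ} (hR : ‖hsVec R‖ ≤ 1) {σ : Matrix c c ℂ} (hσ : IsSubState σ)
    {ε r : ℝ} (hε : 0 < ε) (hr : 0 ≤ r)
    (h : R * Rᴴ ≤ r • ((1 : Matrix a a ℂ) ⊗ₖ ((1 : Matrix b b ℂ) ⊗ₖ σ))) :
    ∃ P : Matrix (b × a × d) (b × a × d) ℂ, IsStarProjection P ∧
      traceFst (traceFst P) ≤ (r / (1 - √(1 - ε ^ 2))) • 1 ∧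
      pureDist (hsVec (foldFst (foldFst R) * P)) (hsVec (foldFst (foldFst R))) ≤ ε := by
  have hδ := one_sub_sqrt_one_sub_sq_pos hε
  obtain ⟨P, hP, htrace, hdist⟩ := exists_isStarProjection_of_le_kronecker hσ.1 hr hδ.le h
  refine ⟨P, hP, ?_, ?_⟩
  · rwa [← le_inv_smul_iff_of_pos hδ, smul_smul, inv_mul_eq_div] at htrace
  · rw [← hsMulRight_hsVec] at hdist ⊢
    refine pureDist_map_self_le (isSymmetricProjection_hsMulRight hP) ?_ hε.le
      (hdist.trans (mul_le_of_le_one_right hδ.le hσ.2))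
    rwa [norm_hsVec_foldFst, norm_hsVec_foldFst]

lemma exists_isStarProjection_pureDist_le_of_fidelity_le [DecidableEq d] [DecidableEq β]
    {R : Matrix (a × β) d ℂ} (hR : ‖hsVec R‖ ≤ 1) {Y : Matrix (a × d) (a × d) ℂ}
    (hY : Y.PosSemidef) {ε q M : ℝ} (hε : 0 < ε) (hq : 0 < q) (hM : 0 < M)
    (hYq : traceFst Y ≤ q • 1)
    (h : ∀ τ : Matrix β β ℂ, IsSubState τ →
      fidelity (R * Rᴴ) ((1 : Matrix a a ℂ) ⊗ₖ τ) ^ 2 ≤ M) :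
    ∃ E : Matrix (a × d) (a × d) ℂ, IsStarProjection E ∧
      E * Y * E ≤ (q * M / (1 - √(1 - ε ^ 2))) • 1 ∧
      pureDist (hsVec (foldFst R * E)) (hsVec (foldFst R)) ≤ ε := by
  have hδ := one_sub_sqrt_one_sub_sq_pos hε
  obtain ⟨E, hE, hle, hnorm⟩ := exists_isStarProjection_of_fidelity_le R hY hq.le
    (show 0 < q * M / (1 - √(1 - ε ^ 2)) by positivity) hM.le hYq h
  refine ⟨1 - E, hE.one_sub, hle, ?_⟩
  rw [div_mul_eq_mul_div, div_le_iff₀ hδ, mul_le_mul_iff_right₀ (by positivity)] at hnorm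
  rw [← hsMulRight_hsVec]
  refine pureDist_map_self_le (isSymmetricProjection_hsMulRight hE.one_sub) ?_ hε.le ?_
  · rwa [norm_hsVec_foldFst]
  · rwa [hsMulRight_hsVec, ← map_sub, Matrix.mul_sub, Matrix.mul_one, sub_sub_cancel]

lemma exists_le_one_kronecker_of_purifications [Fintype c] [DecidableEq c]
    {R R₁ R₂ : Matrix (a × b × c) d ℂ} (hR : ‖hsVec R‖ ≤ 1) (hR₁ : ‖hsVec R₁‖ ≤ 1)
    (hR₂ : ‖hsVec R₂‖ ≤ 1) {ε ε₁ ε₂ : ℝ} (hε : 0 < ε)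
    (h₁ : pureDist (hsVec R₁) (hsVec R) ≤ ε₁) (h₂ : pureDist (hsVec R₂) (hsVec R) ≤ ε₂)
    {σ : Matrix c c ℂ} (hσ : IsSubState σ) {r M : ℝ} (hr : 0 < r) (hM : 0 < M)
    (hmin : R₁ * R₁ᴴ ≤ r • ((1 : Matrix a a ℂ) ⊗ₖ ((1 : Matrix b b ℂ) ⊗ₖ σ)))
    (hmax : ∀ τ : Matrix (b × c) (b × c) ℂ, IsSubState τ →
      fidelity (R₂ * R₂ᴴ) ((1 : Matrix a a ℂ) ⊗ₖ τ) ^ 2 ≤ M) :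
    ∃ X : Matrix (b × c) (a × d) ℂ, ‖hsVec X‖ ≤ 1 ∧
      pureDist (hsVec X) (hsVec (foldFst R)) ≤ 2 * ε + ε₁ + 2 * ε₂ ∧
      ∃ ω : Matrix c c ℂ, IsSubState ω ∧
        X * Xᴴ ≤ (r * M / (1 - √(1 - ε ^ 2)) ^ 2) • ((1 : Matrix b b ℂ) ⊗ₖ ω) := by
  classical
  have hδ := one_sub_sqrt_one_sub_sq_pos hε
  obtain ⟨P, hP, hPtrace, hPdist⟩ :=
    exists_isStarProjection_pureDist_le_of_le_kronecker hR₁ hσ hε hr.le hmin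
  obtain ⟨E, hE, hEle, hEdist⟩ := exists_isStarProjection_pureDist_le_of_fidelity_le hR₂
    (Y := traceFst P) (conjTranspose_foldFst_symm_mul_self hP ▸
      Matrix.posSemidef_conjTranspose_mul_self _) hε (div_pos hr hδ) hM hPtrace hmax
  set T := foldFst (foldFst R₁) with hT
  have hprojP := isSymmetricProjection_hsMulRight (m := c) hP
  have hprojE := isSymmetricProjection_hsMulRight (m := b × c) hE
  have hTP : ‖hsVec (T * P)‖ ≤ 1 := by
    rw [← hsMulRight_hsVec]
    refine (norm_map_le_norm hprojP _).trans ?_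
    rwa [hT, norm_hsVec_foldFst, norm_hsVec_foldFst]
  have hX₀ : ‖hsVec (foldFst.symm (T * P))‖ ≤ 1 := by
    rwa [← norm_hsVec_foldFst, Equiv.apply_symm_apply]
  rw [← norm_hsVec_foldFst] at hR hR₁ hR₂
  rw [← pureDist_hsVec_foldFst] at h₁ h₂
  refine ⟨foldFst.symm (T * P) * E, ?_, ?_, T * P * (T * P)ᴴ, norm_hsVec_le_one_iff.1 hTP, ?_⟩
  · rw [← hsMulRight_hsVec]
    exact (norm_map_le_norm hprojE _).trans hX₀
  · have hX₀dist : pureDist (hsVec (foldFst.symm (T * P))) (hsVec (foldFst R₁)) ≤ ε := by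
      rwa [← pureDist_hsVec_foldFst, Equiv.apply_symm_apply]
    have htriangle := pureDist_triangle hX₀ hR₁ hR
    have hmap := pureDist_map_le_add hprojE hR hX₀ hR₂
    rw [hsMulRight_hsVec, hsMulRight_hsVec] at hmap
    linarith
  · rw [sq (1 - √_), ← div_div, ← div_mul_eq_mul_div]
    refine foldFst_symm_mul_mul_conjTranspose_le hP (by positivity) ?_
    rwa [← Matrix.star_eq_conjTranspose, hE.isSelfAdjoint.star_eq]

lemma exists_mem_closeStates_traceFst_le [Fintype c] [DecidableEq c]
    {ρ ρ₁ ρ₂ : Matrix (a × b × c) (a × b × c) ℂ} (hρ : IsSubState ρ) {ε ε₁ ε₂ : ℝ} (hε : 0 < ε)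
    (h₁ : ρ₁ ∈ closeStates ε₁ ρ) (h₂ : ρ₂ ∈ closeStates ε₂ ρ)
    {σ : Matrix c c ℂ} (hσ : IsSubState σ) {r M : ℝ} (hr : 0 < r) (hM : 0 < M)
    (hmin : ρ₁ ≤ r • ((1 : Matrix a a ℂ) ⊗ₖ ((1 : Matrix b b ℂ) ⊗ₖ σ)))
    (hmax : ∀ τ : Matrix (b × c) (b × c) ℂ, IsSubState τ →
      fidelity ρ₂ ((1 : Matrix a a ℂ) ⊗ₖ τ) ^ 2 ≤ M) :
    ∃ ξ ∈ closeStates (2 * ε + ε₁ + 2 * ε₂) (traceFst ρ), ∃ ω : Matrix c c ℂ, IsSubState ω ∧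
      ξ ≤ (r * M / (1 - √(1 - ε ^ 2)) ^ 2) • ((1 : Matrix b b ℂ) ⊗ₖ ω) := by
  obtain ⟨R, rfl⟩ : ∃ R : Matrix (a × b × c) (a × b × c) ℂ, R * Rᴴ = ρ :=
    ⟨CFC.sqrt ρ, sqrt_mul_conjTranspose_sqrt hρ.1⟩
  obtain ⟨R₁, rfl, hdist₁⟩ := exists_purification_pureDist_eq h₁.1.1 R
  obtain ⟨R₂, rfl, hdist₂⟩ := exists_purification_pureDist_eq h₂.1.1 R
  obtain ⟨X, hX, hdist, ω, hω, hle⟩ := exists_le_one_kronecker_of_purifications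
    (norm_hsVec_le_one_iff.2 hρ) (norm_hsVec_le_one_iff.2 h₁.1) (norm_hsVec_le_one_iff.2 h₂.1) hε
    (hdist₁.trans_le h₁.2) (hdist₂.trans_le h₂.2) hσ hr hM hmin hmax
  refine ⟨X * Xᴴ, ⟨norm_hsVec_le_one_iff.1 hX, ?_⟩, ω, hω, hle⟩
  rw [traceFst_mul_conjTranspose]
  exact (purifiedDist_le_pureDist X (foldFst R)).trans hdist

end PurifiedChainRule

section Entropies

lemma elog2_le_coe_iff {x μ : ℝ} : elog2 x ≤ (μ : EReal) ↔ x ≤ 2 ^ μ := by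
  rcases le_or_gt x 0 with hx | hx
  · simp only [elog2, if_pos hx, bot_le, true_iff]
    exact hx.trans (Real.rpow_nonneg two_pos.le μ)
  · rw [elog2, if_neg hx.not_ge, EReal.coe_le_coe_iff, Real.logb_le_iff_le_rpow one_lt_two hx]

lemma elog2_mono : Monotone elog2 := fun _ _ hxy =>
  EReal.le_of_forall_lt_iff_le.1 fun _ hy =>
    elog2_le_coe_iff.2 (hxy.trans (elog2_le_coe_iff.1 hy.le))

lemma elog2_lt_top (x : ℝ) : elog2 x < ⊤ := by
  unfold elog2
  split_ifs
  · exact bot_lt_top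
  · exact EReal.coe_lt_top _

lemma bot_lt_elog2 {x : ℝ} (hx : 0 < x) : ⊥ < elog2 x := by
  rw [elog2, if_neg hx.not_ge]
  exact EReal.bot_lt_coe _

lemma errorTerm_nonneg {ε : ℝ} (hε : 0 < ε) : 0 ≤ errorTerm ε :=
  Real.logb_nonneg one_lt_two <| (one_le_div (one_sub_sqrt_one_sub_sq_pos hε)).2 <|
    sub_le_self 1 (Real.sqrt_nonneg _)

lemma two_rpow_errorTerm {ε : ℝ} (hε : 0 < ε) : (2 : ℝ) ^ errorTerm ε = 1 / (1 - √(1 - ε ^ 2)) :=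
  Real.rpow_logb two_pos (by norm_num) (one_div_pos.2 (one_sub_sqrt_one_sub_sq_pos hε))

lemma le_one_of_isSubState {n : Type*} [Fintype n] [DecidableEq n] {ρ : Matrix n n ℂ}
    (hρ : IsSubState ρ) : ρ ≤ 1 :=
  (le_trace_smul_one hρ.1).trans (smul_le_of_le_one_left zero_le_one hρ.2)

lemma le_fidelity_of_mem_closeStates {n : Type*} [Fintype n] [DecidableEq n] {ρ ρ' : Matrix n n ℂ}
    (hρ : IsSubState ρ) {ε : ℝ} (h : ρ' ∈ closeStates ε ρ) :
    √(1 - ε ^ 2) - √(1 - ρ.trace.re) ≤ fidelity ρ' ρ := by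
  have htrace : 0 ≤ ρ'.trace.re := (Complex.le_def.1 h.1.1.trace_nonneg).1
  have hgen : √(1 - ε ^ 2) ≤ genFidelity ρ' ρ :=
    Real.sqrt_le_iff.2 ⟨add_nonneg (fidelity_nonneg _ _) (Real.sqrt_nonneg _),
      sub_le_comm.1 (Real.sqrt_le_iff.1 h.2).2⟩
  have hdefect : √((1 - ρ'.trace.re) * (1 - ρ.trace.re)) ≤ √(1 - ρ.trace.re) :=
    Real.sqrt_le_sqrt (mul_le_of_le_one_left (sub_nonneg.2 hρ.2) (sub_le_self 1 htrace))
  exact sub_le_iff_le_add.2 (hgen.trans <| by unfold genFidelity; gcongr)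

variable {a b c : Type*} [Fintype a] [DecidableEq a] [Fintype b] [DecidableEq b]
  [Fintype c] [DecidableEq c]

lemma hMax_le_coe_iff {ρ : Matrix (a × b) (a × b) ℂ} {μ : ℝ} :
    hMax ρ ≤ (μ : EReal) ↔
      ∀ τ : Matrix b b ℂ, IsSubState τ → fidelity ρ ((1 : Matrix a a ℂ) ⊗ₖ τ) ^ 2 ≤ 2 ^ μ := by
  simp only [hMax, hMaxRel, iSup₂_le_iff, elog2_le_coe_iff]

lemma le_smoothHMin {ρ ξ : Matrix (a × b) (a × b) ℂ} {ε l : ℝ} (hξ : ξ ∈ closeStates ε ρ)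
    {ω : Matrix b b ℂ} (hω : IsSubState ω) (h : ξ ≤ ((2 : ℝ) ^ (-l)) • ((1 : Matrix a a ℂ) ⊗ₖ ω)) :
    (l : EReal) ≤ smoothHMin ε ρ :=
  le_iSup₂_of_le ξ hξ (le_iSup₂_of_le ω hω (le_iSup₂_of_le l h le_rfl))

lemma hMax_lt_top (ρ : Matrix (a × b) (a × b) ℂ) : hMax ρ < ⊤ := by
  refine lt_of_le_of_lt (iSup₂_le fun τ hτ => elog2_mono ?_) (elog2_lt_top (fidelity ρ 1 ^ 2))
  have hτone : (1 : Matrix a a ℂ) ⊗ₖ τ ≤ (1 : ℝ) • 1 := by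
    rw [one_smul, ← Matrix.one_kronecker_one, ← add_sub_cancel τ 1, Matrix.kronecker_add,
      le_add_iff_nonneg_right, Matrix.nonneg_iff_posSemidef]
    exact Matrix.PosSemidef.one.kronecker (Matrix.le_iff.1 (le_one_of_isSubState hτ))
  simpa only [one_mul] using fidelity_sq_le_of_le_smul zero_le_one ρ
    (Matrix.PosSemidef.one.kronecker hτ.1) .one hτone

lemma elog2_fidelity_sq_div_card_le_hMax [Nonempty b] (ρ : Matrix (a × b) (a × b) ℂ)
    {σ : Matrix (a × b) (a × b) ℂ} (hσ : IsSubState σ) :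
    elog2 (fidelity ρ σ ^ 2 / Fintype.card b) ≤ hMax ρ := by
  have hcard : (0 : ℝ) < Fintype.card b := Nat.cast_pos.2 Fintype.card_pos
  have hτ : IsSubState ((Fintype.card b : ℝ)⁻¹ • (1 : Matrix b b ℂ)) := by
    refine ⟨Matrix.PosSemidef.one.smul (inv_nonneg.2 hcard.le), le_of_eq ?_⟩
    rw [Matrix.trace_smul, Matrix.trace_one, Complex.smul_re, Complex.natCast_re, smul_eq_mul,
      inv_mul_cancel₀ hcard.ne']
  have hle : σ ≤ (Fintype.card b : ℝ) •
      ((1 : Matrix a a ℂ) ⊗ₖ ((Fintype.card b : ℝ)⁻¹ • (1 : Matrix b b ℂ))) := by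
    rw [← Matrix.kronecker_smul, smul_smul, mul_inv_cancel₀ hcard.ne', one_smul,
      Matrix.one_kronecker_one]
    exact le_one_of_isSubState hσ
  refine le_iSup₂_of_le _ hτ (elog2_mono ((div_le_iff₀' hcard).2 ?_))
  exact fidelity_sq_le_of_le_smul hcard.le ρ hσ.1 (Matrix.PosSemidef.one.kronecker hτ.1) hle

lemma smoothHMax_lt_top {ρ : Matrix (a × b) (a × b) ℂ} (hρ : IsSubState ρ) {ε : ℝ} (hε : 0 ≤ ε) :
    smoothHMax ε ρ < ⊤ :=
  (iInf₂_le ρ (mem_closeStates_self hρ hε)).trans_lt (hMax_lt_top ρ)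

lemma bot_lt_smoothHMax {ρ : Matrix (a × b) (a × b) ℂ} (hρ : IsSubState ρ) {ε : ℝ}
    (h : ε ^ 2 < ρ.trace.re) : ⊥ < smoothHMax ε ρ := by
  have : Nonempty b := by
    by_contra hb
    have := not_nonempty_iff.1 hb
    refine ((sq_nonneg ε).trans_lt h).ne' ?_
    rw [Matrix.trace_eq_zero_of_isEmpty, Complex.zero_re]
  have hη : 0 < √(1 - ε ^ 2) - √(1 - ρ.trace.re) :=
    sub_pos.2 (Real.sqrt_lt_sqrt (sub_nonneg.2 hρ.2) (sub_lt_sub_left h 1))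
  set η := √(1 - ε ^ 2) - √(1 - ρ.trace.re)
  refine (bot_lt_elog2 (x := η ^ 2 / Fintype.card b) (by positivity)).trans_le
    (le_iInf₂ fun ρ' hρ' => ?_)
  refine le_trans (elog2_mono ?_) (elog2_fidelity_sq_div_card_le_hMax ρ' hρ)
  gcongr
  exact le_fidelity_of_mem_closeStates hρ hρ'

section SmoothChainRule

variable {ρ ρ₂ : Matrix (a × b × c) (a × b × c) ℂ} {ρ₁ : Matrix ((a × b) × c) ((a × b) × c) ℂ}
  {ε ε₁ ε₂ l : ℝ} {σ : Matrix c c ℂ}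

lemma coe_sub_le_smoothHMin_traceFst (hρ : IsSubState ρ) (hε : 0 < ε)
    (h₁ : ρ₁ ∈ closeStates ε₁ (assocLeft ρ)) (h₂ : ρ₂ ∈ closeStates ε₂ ρ) (hσ : IsSubState σ)
    (hmin : ρ₁ ≤ ((2 : ℝ) ^ (-l)) • ((1 : Matrix (a × b) (a × b) ℂ) ⊗ₖ σ)) {μ : ℝ}
    (hmax : hMax ρ₂ ≤ (μ : EReal)) :
    ((l - 2 * errorTerm ε - μ : ℝ) : EReal)
      ≤ smoothHMin (2 * ε + ε₁ + 2 * ε₂) (traceFst ρ) := by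
  have h₁' : ρ₁.submatrix (Equiv.prodAssoc a b c).symm (Equiv.prodAssoc a b c).symm
      ∈ closeStates ε₁ ρ :=
    submatrix_mem_closeStates (hρ.1.submatrix _) h₁ (Equiv.prodAssoc a b c).symm
  obtain ⟨ξ, hξ, ω, hω, hle⟩ := exists_mem_closeStates_traceFst_le hρ hε h₁' h₂ hσ
    (Real.rpow_pos_of_pos two_pos (-l)) (Real.rpow_pos_of_pos two_pos μ)
    (submatrix_prodAssoc_symm_le hmin) (hMax_le_coe_iff.1 hmax)
  refine le_smoothHMin hξ hω (hle.trans_eq ?_)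
  congr 1
  calc (2 : ℝ) ^ (-l) * 2 ^ μ / (1 - √(1 - ε ^ 2)) ^ 2
      = 2 ^ (-l) * 2 ^ μ * (2 ^ errorTerm ε) ^ 2 := by
        rw [two_rpow_errorTerm hε, one_div, inv_pow, div_eq_mul_inv]
    _ = 2 ^ (-l + μ + (errorTerm ε + errorTerm ε)) := by
        rw [Real.rpow_add two_pos, Real.rpow_add two_pos, Real.rpow_add two_pos, ← sq]
    _ = 2 ^ (-(l - 2 * errorTerm ε - μ)) := by ring_nf

lemma coe_sub_smoothHMin_le_smoothHMax (hρ : IsSubState ρ) (hε : 0 < ε)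
    (h₁ : ρ₁ ∈ closeStates ε₁ (assocLeft ρ)) (hσ : IsSubState σ)
    (hmin : ρ₁ ≤ ((2 : ℝ) ^ (-l)) • ((1 : Matrix (a × b) (a × b) ℂ) ⊗ₖ σ)) :
    ((l - 2 * errorTerm ε : ℝ) : EReal) - smoothHMin (2 * ε + ε₁ + 2 * ε₂) (traceFst ρ)
      ≤ smoothHMax ε₂ ρ := by
  refine le_iInf₂ fun ρ₂ h₂ => EReal.le_of_forall_lt_iff_le.1 fun μ hμ => ?_
  have hle := coe_sub_le_smoothHMin_traceFst hρ hε h₁ h₂ hσ hmin hμ.le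
  rw [EReal.coe_sub, EReal.sub_le_iff_le_add (by simp) (by simp), add_comm] at hle
  rwa [EReal.sub_le_iff_le_add (by simp) (by simp)]

end SmoothChainRule

end Entropies

end SmoothEntropy

end

theorem mainTheorem3_general {a b c : Type*} [Fintype a] [DecidableEq a] [Fintype b]
    [DecidableEq b] [Fintype c] [DecidableEq c]
    (ρ : Matrix (a × b × c) (a × b × c) ℂ) (hρ : SmoothEntropy.IsSubState ρ)
    (ε ε' ε'' : ℝ) (hε : 0 < ε) (hε'' : 0 ≤ ε'') (hρε'' : ε'' ^ 2 < ρ.trace.re) :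
    SmoothEntropy.smoothHMin ε' (SmoothEntropy.assocLeft ρ) ≤
      SmoothEntropy.smoothHMax ε'' ρ
        + SmoothEntropy.smoothHMin (2 * ε + ε' + 2 * ε'') (SmoothEntropy.traceFst ρ)
        + ((2 * SmoothEntropy.errorTerm ε : ℝ) : EReal) := by
  refine iSup₂_le fun ρ₁ h₁ => iSup₂_le fun σ hσ => iSup₂_le fun l hl => ?_
  have htop := SmoothEntropy.smoothHMax_lt_top hρ hε''
  have hbot := SmoothEntropy.bot_lt_smoothHMax hρ hρε''
  have hle := SmoothEntropy.coe_sub_smoothHMin_le_smoothHMax (ε₂ := ε'') hρ hε h₁ hσ hl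
  rwa [EReal.sub_le_iff_le_add (.inr htop.ne) (.inr hbot.ne'), EReal.coe_sub,
    EReal.sub_le_iff_le_add (.inl (EReal.coe_ne_bot _)) (.inl (EReal.coe_ne_top _))] at hle

theorem mainTheorem3 {a b c : Type*} [Fintype a] [DecidableEq a] [Fintype b] [DecidableEq b]
    [Fintype c] [DecidableEq c]
    (ρ : Matrix (a × b × c) (a × b × c) ℂ) (hρ : SmoothEntropy.IsSubState ρ)
    (ε ε' ε'' : ℝ) (hε : 0 < ε) (hε' : 0 ≤ ε') (hε'' : 0 ≤ ε'')
    (hρε'' : ε'' ^ 2 < ρ.trace.re) :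
    SmoothEntropy.smoothHMin ε' (SmoothEntropy.assocLeft ρ) ≤
      SmoothEntropy.smoothHMax ε'' ρ
        + SmoothEntropy.smoothHMin (2 * ε + ε' + 2 * ε'') (SmoothEntropy.traceFst ρ)
        + ((3 * SmoothEntropy.errorTerm ε : ℝ) : EReal) := by
  refine (mainTheorem3_general ρ hρ ε ε' ε'' hε hε'' hρε'').trans ?_
  gcongr
  · exact SmoothEntropy.errorTerm_nonneg hε
  · norm_num
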